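/- **Antipode of the noncommutative Lagrange series.** Let $R$ be a commutative ring and let $\mathbf{Sym}=R\langle S_1,S_2,\dots\rangle$ be the Hopf algebra of noncommutative symmetric functions, with $S_0=1$, $\Delta S_n=\sum_{i=0}^n S_i\otimes S_{n-i}$ and antipode $\tilde\omega$. Let $\Lambda_n$ be the elementary functions, $\sum_{n\ge 0}(-1)^n\Lambda_n t^n=\big(\sum_{n\ge 0} S_nt^n\big)^{-1}$. Let $g_n$ and $g_n^{(2)}$ be the homogeneous components of degree $n$ of the series defined by $g=\sum_{n\ge 0}S_n g^n$ and $g^{(2)}=\sum_{n\ge 0}S_n\,(g^{(2)})^{2n}$, with constant term $1$. For a composition $I=(i_1,\dots,i_r)$ put $\ell(I)=r$, $\bar I=(i_r,\dots,i_1)$, $S^I=S_{i_1}\cdots S_{i_r}$, $\Lambda^I=\Lambda_{i_1}\cdots\Lambda_{i_r}$, $g^I=g_{i_1}\cdots g_{i_r}$, and let $I^\sim$ be the conjugate composition, whose descent set is the mirror image of the complement of the descent set of $I$. The families $S^I,\Lambda^I,g^I$ are bases of $\mathbf{Sym}$; let $M_I$ (the monomial functions), $V_I$, $c_I$ be the respective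 dual bases of $QSym$. Let $F\mapsto\tilde F$ be the algebra automorphism $\Lambda_n\mapsto g_n$ of $\mathbf{Sym}$ (an involution), and let $\chi$ be the linear involution $g^I\mapsto g^{\bar I}$. Then for every $n\ge 0$: 1. $\tilde\omega(g_n)=(-1)^n\,\widetilde{\chi\big(g_n^{(2)}\big)}$. 2. For every composition $I\vDash n$, $$\langle c_I,\tilde\omega(g_n)\rangle=(-1)^n\sum_{J\vDash n}\langle V_I,g^J\rangle\,\langle M_{\bar J},g_n\rangle .$$ 3. This formula is combinatorial and cancellation-free: for all $I,J\vDash n$, $$\langle V_I,g^J\rangle=(-1)^{n-\ell(I)}\,q_{I,J},\qquad \langle M_{\bar J},g_n\rangle=p_{\bar J},$$ where $p_{\bar J}$ is the number of nondecreasing parking functions (words $a_1\le\dots\le a_n$ with $1\le a_i\le i$) whose type, the sequence of nonzero multiplicities of the letters in increasing order of the letters, is $\bar J$; and, for $J=(j_1,\dots,j_r)$, $q_{I,J}$ is the number of sequences $(a^{(1)},\dots,a^{(r)})$ of parking quasi-ribbons of shapes $I_1^\sim,\dots,I_r^\sim$ if $I$ is a concatenation $I_1\cdots I_r$ with $I_k\vDash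 j_k$ for every $k$, and $q_{I,J}=0$ if $I$ is not of this form. Here a parking quasi-ribbon of shape $K\vDash m$ is a nondecreasing parking function $a_1\cdots a_m$ such that $a_d<a_{d+1}$ for every descent $d$ of $K$. Consequently $$\tilde\omega(g_n)=\sum_{I\vDash n}(-1)^{\ell(I)}\Big(\sum_{J\vDash n}q_{I,J}\,p_{\bar J}\Big)g^I .$$ -/

import Mathlib

open scoped TensorProduct

namespace LagrangeSym

noncomputable section

/-! ### Noncommutative symmetric functions -/

/-- The algebra `Sym` of noncommutative symmetric functions over `R`: the free associative algebra
on the complete functions `S_1, S_2, …`. -/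
abbrev NSym (R : Type*) [CommRing R] : Type _ := FreeAlgebra R ℕ+

variable (R : Type*) [CommRing R]

/-- The complete symmetric function `S_n`, with `S_0 = 1`. -/
def S : ℕ → NSym R
  | 0 => 1
  | n + 1 => FreeAlgebra.ι R n.succPNat

theorem S_zero : S R 0 = 1 := rfl

theorem S_coe (k : ℕ+) : S R (k : ℕ) = FreeAlgebra.ι R k := by
  obtain ⟨n, rfl⟩ : ∃ n : ℕ, k = n.succPNat := ⟨k.natPred, by simp⟩
  rfl

variable {R} in
/-- The unique algebra morphism from `Sym` that sends `S_n` to `f n` for `n ≥ 1`. -/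
def liftS {A : Type*} [Semiring A] [Algebra R A] (f : ℕ → A) : NSym R →ₐ[R] A :=
  FreeAlgebra.lift R (fun k : ℕ+ => f k)

variable {R} in
theorem liftS_S {A : Type*} [Semiring A] [Algebra R A] (f : ℕ → A) (h0 : f 0 = 1) (n : ℕ) :
    liftS (R := R) f (S R n) = f n := by
  cases n with
  | zero => simp [S_zero, h0]
  | succ n => simp [S, liftS]

variable {R} in
theorem algHom_ext_S {A : Type*} [Semiring A] [Algebra R A] {f f' : NSym R →ₐ[R] A}
    (h : ∀ n, f (S R n) = f' (S R n)) : f = f' := by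
  apply FreeAlgebra.hom_ext
  funext k
  simpa [S_coe] using h k

/-! ### The Hopf algebra structure: `Δ S_n = ∑ S_i ⊗ S_{n-i}` -/

/-- The coproduct of `Sym`. -/
def comulS : NSym R →ₐ[R] NSym R ⊗[R] NSym R :=
  liftS fun n => ∑ p ∈ Finset.HasAntidiagonal.antidiagonal n, S R p.1 ⊗ₜ[R] S R p.2

/-- The counit of `Sym`. -/
def counitS : NSym R →ₐ[R] R := liftS fun n => if n = 0 then 1 else 0

theorem comulS_S (n : ℕ) :
    comulS R (S R n) = ∑ p ∈ Finset.HasAntidiagonal.antidiagonal n, S R p.1 ⊗ₜ[R] S R p.2 := by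
  unfold comulS
  rw [liftS_S]
  simp [S_zero, Algebra.TensorProduct.one_def]

theorem counitS_S (n : ℕ) : counitS R (S R n) = if n = 0 then 1 else 0 := by
  unfold counitS
  rw [liftS_S]
  simp

instance : Bialgebra R (NSym R) :=
  Bialgebra.ofAlgHom (comulS R) (counitS R)
    (by
      apply algHom_ext_S
      intro n
      simp only [AlgHom.comp_apply, comulS_S, map_sum, Algebra.TensorProduct.map_tmul,
        AlgHom.id_apply, TensorProduct.sum_tmul, TensorProduct.tmul_sum]
      rw [Finset.sum_sigma', Finset.sum_sigma']
      refine Finset.sum_nbij' (fun x => ⟨(x.2.1, x.2.2 + x.1.2), (x.2.2, x.1.2)⟩)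
        (fun x => ⟨(x.1.1 + x.2.1, x.2.2), (x.1.1, x.2.1)⟩) ?_ ?_ ?_ ?_ ?_
      · rintro ⟨⟨a, b⟩, ⟨c, d⟩⟩ h
        simp only [Finset.mem_sigma, Finset.HasAntidiagonal.mem_antidiagonal] at h ⊢
        refine ⟨?_, ?_⟩
        · omega
        · trivial
      · rintro ⟨⟨a, b⟩, ⟨c, d⟩⟩ h
        simp only [Finset.mem_sigma, Finset.HasAntidiagonal.mem_antidiagonal] at h ⊢
        refine ⟨?_, ?_⟩
        · omega
        · trivial
      · rintro ⟨⟨a, b⟩, ⟨c, d⟩⟩ h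
        simp only [Finset.mem_sigma, Finset.HasAntidiagonal.mem_antidiagonal] at h
        obtain ⟨h1, rfl⟩ := h
        rfl
      · rintro ⟨⟨a, b⟩, ⟨c, d⟩⟩ h
        simp only [Finset.mem_sigma, Finset.HasAntidiagonal.mem_antidiagonal] at h
        obtain ⟨h1, rfl⟩ := h
        rfl
      · rintro ⟨⟨a, b⟩, ⟨c, d⟩⟩ h
        rfl)
    (by
      apply algHom_ext_S
      intro n
      simp only [AlgHom.comp_apply, comulS_S, map_sum, Algebra.TensorProduct.map_tmul,
        AlgHom.id_apply, counitS_S]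
      rw [Finset.sum_eq_single (0, n)]
      · simp
      · rintro ⟨a, b⟩ h hne
        have : a ≠ 0 := by
          rintro rfl
          simp_all
        simp [this]
      · simp)
    (by
      apply algHom_ext_S
      intro n
      simp only [AlgHom.comp_apply, comulS_S, map_sum, Algebra.TensorProduct.map_tmul,
        AlgHom.id_apply, counitS_S]
      rw [Finset.sum_eq_single (n, 0)]
      · simp
      · rintro ⟨a, b⟩ h hne
        have : b ≠ 0 := by
          rintro rfl
          simp_all
        simp [this]
      · simp)

/-- The generating series `σ_t = ∑ S_n t^n`. -/
def sigma : PowerSeries (NSym R) := PowerSeries.mk (S R)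

/-- The elementary symmetric functions `Λ_n`, defined by `∑ (-1)^n Λ_n t^n = σ_t⁻¹`. -/
def Lam (n : ℕ) : NSym R :=
  (-1) ^ n * PowerSeries.coeff n (PowerSeries.invOfUnit (sigma R) 1)

/-- `S_n(-A) = (-1)^n Λ_n`. -/
def Sneg (n : ℕ) : NSym R := (-1) ^ n * Lam R n

theorem Sneg_eq (n : ℕ) :
    Sneg R n = PowerSeries.coeff n (PowerSeries.invOfUnit (sigma R) 1) := by
  rw [Sneg, Lam, ← mul_assoc, ← pow_add, ← two_mul]
  simp

theorem mk_Sneg : PowerSeries.mk (Sneg R) = PowerSeries.invOfUnit (sigma R) 1 := by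
  ext n
  rw [PowerSeries.coeff_mk, Sneg_eq]

theorem sigma_mul_Sneg : sigma R * PowerSeries.mk (Sneg R) = 1 := by
  rw [mk_Sneg]
  exact PowerSeries.mul_invOfUnit _ _ (by simp [sigma, S_zero])

theorem Sneg_mul_sigma : PowerSeries.mk (Sneg R) * sigma R = 1 := by
  rw [mk_Sneg]
  exact PowerSeries.invOfUnit_mul _ _ (by simp [sigma, S_zero])

theorem Sneg_zero : Sneg R 0 = 1 := by
  rw [Sneg_eq]
  simp

theorem Lam_zero : Lam R 0 = 1 := by
  simpa [Sneg] using Sneg_zero R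

theorem sum_S_Sneg (n : ℕ) :
    ∑ p ∈ Finset.HasAntidiagonal.antidiagonal n, S R p.1 * Sneg R p.2 = if n = 0 then 1 else 0 := by
  have := congrArg (PowerSeries.coeff n) (sigma_mul_Sneg R)
  simpa [PowerSeries.coeff_mul, PowerSeries.coeff_one, sigma] using this

theorem sum_Sneg_S (n : ℕ) :
    ∑ p ∈ Finset.HasAntidiagonal.antidiagonal n, Sneg R p.1 * S R p.2 = if n = 0 then 1 else 0 := by
  have := congrArg (PowerSeries.coeff n) (Sneg_mul_sigma R)
  simpa [PowerSeries.coeff_mul, PowerSeries.coeff_one, sigma] using this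

/-- The anti-automorphism of `Sym` that sends `S_n` to `(-1)^n Λ_n`, as a morphism to the
opposite algebra. -/
def antiOp : NSym R →ₐ[R] (NSym R)ᵐᵒᵖ := liftS fun n => MulOpposite.op (Sneg R n)

/-- The linear anti-automorphism of `Sym` that sends `S_n` to `(-1)^n Λ_n`. -/
def anti : NSym R →ₗ[R] NSym R :=
  (MulOpposite.opLinearEquiv R).symm.toLinearMap ∘ₗ (antiOp R).toLinearMap

theorem anti_apply (x : NSym R) : anti R x = MulOpposite.unop (antiOp R x) := rfl

theorem anti_one : anti R 1 = 1 := by simp [anti_apply]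

theorem anti_mul (x y : NSym R) : anti R (x * y) = anti R y * anti R x := by
  simp [anti_apply]

theorem anti_S (n : ℕ) : anti R (S R n) = Sneg R n := by
  rw [anti_apply, antiOp, liftS_S]
  · simp
  · simp [Sneg_zero]

theorem anti_rTensor (x : NSym R) :
    LinearMap.mul' R (NSym R) ((anti R).rTensor (NSym R) (comulS R x)) =
      algebraMap R (NSym R) (counitS R x) := by
  induction x using FreeAlgebra.induction with
  | grade0 r =>
    rw [AlgHom.commutes, AlgHom.commutes, Algebra.TensorProduct.algebraMap_apply]
    simp [Algebra.algebraMap_eq_smul_one, anti_one]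
  | grade1 k =>
    rw [← S_coe, comulS_S, counitS_S]
    simp only [map_sum, LinearMap.rTensor_tmul, LinearMap.mul'_apply, anti_S, sum_Sneg_S]
    split_ifs <;> simp
  | add a b ha hb => simp only [map_add, ha, hb]
  | mul a b ha hb =>
    have key : ∀ (t : NSym R ⊗[R] NSym R) (r : R),
        LinearMap.mul' R (NSym R) ((anti R).rTensor (NSym R) t) = algebraMap R (NSym R) r →
        ∀ s : NSym R ⊗[R] NSym R,
          LinearMap.mul' R (NSym R) ((anti R).rTensor (NSym R) (t * s)) =
          algebraMap R (NSym R) r *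
            LinearMap.mul' R (NSym R) ((anti R).rTensor (NSym R) s) := by
      intro t r ht s
      induction s using TensorProduct.induction_on with
      | zero => simp
      | add s s' h h' => rw [mul_add, map_add, map_add, h, h', map_add, map_add, mul_add]
      | tmul c d =>
        have h1 : ∀ t : NSym R ⊗[R] NSym R,
            LinearMap.mul' R (NSym R) ((anti R).rTensor (NSym R) (t * c ⊗ₜ[R] d)) =
            anti R c * LinearMap.mul' R (NSym R) ((anti R).rTensor (NSym R) t) * d := by
          intro t
          induction t using TensorProduct.induction_on with
          | zero => simp
          | add s s' h h' =>
            rw [add_mul, map_add, map_add, h, h', map_add, map_add, mul_add, add_mul]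
          | tmul a b => simp [anti_mul, mul_assoc]
        rw [h1, ht, ← Algebra.commutes]
        simp [mul_assoc]
    rw [map_mul, key _ _ ha, hb, map_mul, map_mul]

theorem anti_lTensor (x : NSym R) :
    LinearMap.mul' R (NSym R) ((anti R).lTensor (NSym R) (comulS R x)) =
      algebraMap R (NSym R) (counitS R x) := by
  induction x using FreeAlgebra.induction with
  | grade0 r =>
    rw [AlgHom.commutes, AlgHom.commutes, Algebra.TensorProduct.algebraMap_apply]
    simp [Algebra.algebraMap_eq_smul_one, anti_one]
  | grade1 k =>
    rw [← S_coe, comulS_S, counitS_S]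
    simp only [map_sum, LinearMap.lTensor_tmul, LinearMap.mul'_apply, anti_S, sum_S_Sneg]
    split_ifs <;> simp
  | add a b ha hb => simp only [map_add, ha, hb]
  | mul a b ha hb =>
    have key : ∀ (t : NSym R ⊗[R] NSym R) (r : R),
        LinearMap.mul' R (NSym R) ((anti R).lTensor (NSym R) t) = algebraMap R (NSym R) r →
        ∀ s : NSym R ⊗[R] NSym R,
          LinearMap.mul' R (NSym R) ((anti R).lTensor (NSym R) (s * t)) =
          LinearMap.mul' R (NSym R) ((anti R).lTensor (NSym R) s) *
            algebraMap R (NSym R) r := by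
      intro t r ht s
      induction s using TensorProduct.induction_on with
      | zero => simp
      | add s s' h h' => rw [add_mul, map_add, map_add, h, h', map_add, map_add, add_mul]
      | tmul c d =>
        have h1 : ∀ t : NSym R ⊗[R] NSym R,
            LinearMap.mul' R (NSym R) ((anti R).lTensor (NSym R) (c ⊗ₜ[R] d * t)) =
            c * LinearMap.mul' R (NSym R) ((anti R).lTensor (NSym R) t) * anti R d := by
          intro t
          induction t using TensorProduct.induction_on with
          | zero => simp
          | add s s' h h' =>
            rw [mul_add, map_add, map_add, h, h', map_add, map_add, mul_add, add_mul]
          | tmul a b => simp [anti_mul, mul_assoc]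
        rw [h1, ht, mul_assoc, Algebra.commutes]
        simp [mul_assoc]
    rw [map_mul, key _ _ hb, ha, map_mul, map_mul]

/-- `Sym` as a Hopf algebra. -/
instance : HopfAlgebra R (NSym R) where
  antipode := anti R
  mul_antipode_rTensor_comul := LinearMap.ext (anti_rTensor R)
  mul_antipode_lTensor_comul := LinearMap.ext (anti_lTensor R)

/-! ### Lagrange series -/

section Lagrange

variable {A : Type*} [Ring A]

theorem coeff_pow_congr {F G : PowerSeries A} {n : ℕ}
    (h : ∀ m ≤ n, PowerSeries.coeff m F = PowerSeries.coeff m G) (k : ℕ) :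
    ∀ m ≤ n, PowerSeries.coeff m (F ^ k) = PowerSeries.coeff m (G ^ k) := by
  induction k with
  | zero => simp
  | succ k ih =>
    intro m hm
    rw [pow_succ, pow_succ, PowerSeries.coeff_mul, PowerSeries.coeff_mul]
    refine Finset.sum_congr rfl fun p hp => ?_
    have := Finset.HasAntidiagonal.mem_antidiagonal.mp hp
    rw [ih _ (by omega), h _ (by omega)]

/-- The coefficients of the series `G` with `G = 1 + ∑_{j ≥ 1} a_j t^j G^{k j}`, read off
recursively: `[t^n] G = ∑_{1 ≤ j ≤ n} a_j [t^{n-j}] G^{k j}`. -/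
def lagrangeCoeff (a : ℕ → A) (k : ℕ) : ℕ → A
  | 0 => 1
  | n + 1 => ∑ j ∈ Finset.range (n + 1), a (j + 1) * PowerSeries.coeff (n - j)
      ((PowerSeries.mk fun m => if m < n + 1 then lagrangeCoeff a k m else 0) ^ (k * (j + 1)))

/-- The power series `G = 1 + ∑_{j ≥ 1} a_j t^j G^{k j}`. -/
def lagrangeSeries (a : ℕ → A) (k : ℕ) : PowerSeries A := PowerSeries.mk (lagrangeCoeff a k)

theorem lagrangeCoeff_zero (a : ℕ → A) (k : ℕ) : lagrangeCoeff a k 0 = 1 := by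
  rw [lagrangeCoeff]

theorem lagrangeCoeff_succ (a : ℕ → A) (k n : ℕ) :
    lagrangeCoeff a k (n + 1) = ∑ j ∈ Finset.range (n + 1),
      a (j + 1) * PowerSeries.coeff (n - j) (lagrangeSeries a k ^ (k * (j + 1))) := by
  rw [lagrangeCoeff]
  refine Finset.sum_congr rfl fun j hj => ?_
  congr 1
  refine coeff_pow_congr (n := n) (fun m hm => ?_) _ _ (by omega)
  rw [PowerSeries.coeff_mk, lagrangeSeries, PowerSeries.coeff_mk, if_pos (by omega)]

/-- The functional equation `G = ∑_{j ≥ 0} a_j t^j G^{k j}`, coefficient by coefficient. -/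
theorem lagrangeSeries_eq (a : ℕ → A) (h0 : a 0 = 1) (k n : ℕ) :
    PowerSeries.coeff n (lagrangeSeries a k) = ∑ j ∈ Finset.range (n + 1),
      a j * PowerSeries.coeff (n - j) (lagrangeSeries a k ^ (k * j)) := by
  cases n with
  | zero => simp [lagrangeSeries, lagrangeCoeff_zero, h0]
  | succ n =>
    rw [lagrangeSeries, PowerSeries.coeff_mk, lagrangeCoeff_succ, Finset.sum_range_succ' _ (n + 1)]
    simp [PowerSeries.coeff_one, lagrangeSeries]

/-- The functional equation has only one solution. -/
theorem lagrange_unique (a : ℕ → A) (k : ℕ) (F G : PowerSeries A)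
    (hF0 : PowerSeries.coeff 0 F = 1) (hG0 : PowerSeries.coeff 0 G = 1)
    (hF : ∀ n, PowerSeries.coeff n F = ∑ j ∈ Finset.range (n + 1),
      a j * PowerSeries.coeff (n - j) (F ^ (k * j)))
    (hG : ∀ n, PowerSeries.coeff n G = ∑ j ∈ Finset.range (n + 1),
      a j * PowerSeries.coeff (n - j) (G ^ (k * j))) : F = G := by
  have key : ∀ n, ∀ m ≤ n, PowerSeries.coeff m F = PowerSeries.coeff m G := by
    intro n
    induction n with
    | zero =>
      intro m hm
      obtain rfl : m = 0 := by omega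
      rw [hF0, hG0]
    | succ n ih =>
      intro m hm
      rcases Nat.lt_or_ge m (n + 1) with h | h
      · exact ih m (by omega)
      · obtain rfl : m = n + 1 := by omega
        rw [hF, hG, Finset.sum_range_succ', Finset.sum_range_succ' _ (n + 1)]
        congr 1
        refine Finset.sum_congr rfl fun j hj => ?_
        rw [coeff_pow_congr ih _ _ (by omega)]
  ext n
  exact key n n le_rfl

end Lagrange

/-- The noncommutative Lagrange series `g = 1 + ∑_{n ≥ 1} S_n g^n`: `g R n` is its homogeneous
component `g_n` of degree `n`. -/
def g (n : ℕ) : NSym R := lagrangeCoeff (S R) 1 n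

/-- The homogeneous component of degree `n` of the `2`-Lagrange series
`g^{(2)} = ∑_{n ≥ 0} S_n (g^{(2)})^{2n}`. -/
def g2 (n : ℕ) : NSym R := lagrangeCoeff (S R) 2 n

theorem g_zero : g R 0 = 1 := lagrangeCoeff_zero _ _

theorem mk_g_eq (n : ℕ) : g R n = ∑ j ∈ Finset.range (n + 1),
    S R j * PowerSeries.coeff (n - j) (PowerSeries.mk (g R) ^ j) := by
  have := lagrangeSeries_eq (S R) (S_zero R) 1 n
  simp only [lagrangeSeries, one_mul, PowerSeries.coeff_mk] at this
  exact this

/-! ### The automorphisms `S_n ↦ Λ_n` and `S_n ↦ g_n` -/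

/-- The algebra morphism `S_n ↦ Λ_n`. -/
def lamHom : NSym R →ₐ[R] NSym R := liftS (Lam R)

theorem lamHom_S (n : ℕ) : lamHom R (S R n) = Lam R n := liftS_S _ (Lam_zero R) n

theorem lamHom_Lam (n : ℕ) : lamHom R (Lam R n) = S R n := by
  have h1 : PowerSeries.mk (Lam R) * PowerSeries.mk (fun n => (-1) ^ n * S R n) = 1 := by
    ext n
    have := congrArg (fun x => (-1) ^ n * x) (sum_Sneg_S R n)
    simp only [Finset.mul_sum] at this
    rw [PowerSeries.coeff_mul, PowerSeries.coeff_one]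
    simp only [PowerSeries.coeff_mk]
    refine Eq.trans (Eq.trans (Finset.sum_congr rfl fun p hp => ?_) this) ?_
    · obtain ⟨i, j⟩ := p
      have hp := Finset.HasAntidiagonal.mem_antidiagonal.mp hp
      simp only at hp
      subst hp
      have hc : Commute ((-1 : NSym R) ^ j) (Lam R i) := by
        exact ((Commute.one_left _).neg_left).pow_left j
      simp only [Sneg]
      rw [← mul_assoc, ← hc.eq, mul_assoc, mul_assoc, ← mul_assoc ((-1) ^ (i + j)), ← pow_add,
        show i + j + i = 2 * i + j by ring, pow_add, pow_mul]
      simp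
    · split_ifs with h <;> simp [h]
  have h2 : PowerSeries.mk (fun n => (-1) ^ n * lamHom R (Lam R n)) * PowerSeries.mk (Lam R) = 1 := by
    ext n
    have := congrArg (lamHom R) (sum_Sneg_S R n)
    rw [map_sum] at this
    rw [PowerSeries.coeff_mul, PowerSeries.coeff_one]
    simp only [PowerSeries.coeff_mk]
    refine Eq.trans (Eq.trans (Finset.sum_congr rfl fun p _ => ?_) this) ?_
    · simp [Sneg, lamHom_S]
    · split_ifs <;> simp
  have h3 := left_inv_eq_right_inv h2 h1
  have h4 := congrArg (PowerSeries.coeff n) h3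
  simp only [PowerSeries.coeff_mk] at h4
  have h5 := congrArg (fun x => (-1) ^ n * x) h4
  simp only [← mul_assoc, ← pow_add, ← two_mul] at h5
  simpa using h5

/-- The algebra automorphism `S_n ↦ Λ_n` of `Sym`. -/
def lamEquiv : NSym R ≃ₐ[R] NSym R :=
  AlgEquiv.ofAlgHom (lamHom R) (lamHom R)
    (algHom_ext_S fun n => by simp [lamHom_S, lamHom_Lam])
    (algHom_ext_S fun n => by simp [lamHom_S, lamHom_Lam])

theorem lamEquiv_S (n : ℕ) : lamEquiv R (S R n) = Lam R n := lamHom_S R n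

/-- The algebra morphism `S_n ↦ g_n`. -/
def gHom : NSym R →ₐ[R] NSym R := liftS (g R)

theorem gHom_S (n : ℕ) : gHom R (S R n) = g R n := liftS_S _ (g_zero R) n

/-- The elements `K_n` with `S_n = ∑_{j ≤ n} K_j [t^{n-j}] σ_t^j`; the morphism `S_n ↦ K_n` is
inverse to `S_n ↦ g_n`. -/
def KSym (n : ℕ) : NSym R :=
  S R n - ∑ j : Fin n, KSym j * PowerSeries.coeff (n - j) (sigma R ^ (j : ℕ))

theorem coeff_zero_pow {A : Type*} [Ring A] {F : PowerSeries A}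
    (hF : PowerSeries.coeff 0 F = 1) (k : ℕ) : PowerSeries.coeff 0 (F ^ k) = 1 := by
  simp only [PowerSeries.coeff_zero_eq_constantCoeff] at *
  simp [hF]

theorem KSym_eq (n : ℕ) :
    KSym R n = S R n - ∑ j ∈ Finset.range n, KSym R j * PowerSeries.coeff (n - j) (sigma R ^ j) := by
  rw [KSym, Finset.sum_range]

theorem KSym_zero : KSym R 0 = 1 := by
  rw [KSym_eq]
  simp [S_zero]

theorem S_eq_KSym (n : ℕ) : S R n =
    ∑ j ∈ Finset.range (n + 1), KSym R j * PowerSeries.coeff (n - j) (sigma R ^ j) := by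
  rw [Finset.sum_range_succ, Nat.sub_self, coeff_zero_pow (by simp [sigma, S_zero]), mul_one, KSym_eq]
  abel

/-- The algebra morphism `S_n ↦ K_n`. -/
def KHom : NSym R →ₐ[R] NSym R := liftS (KSym R)

theorem KHom_S (n : ℕ) : KHom R (S R n) = KSym R n := liftS_S _ (KSym_zero R) n

theorem gHom_KSym (n : ℕ) : gHom R (KSym R n) = S R n := by
  induction n using Nat.strong_induction_on with
  | _ n ih =>
    have hm : PowerSeries.map (gHom R : NSym R →+* NSym R) (sigma R) = PowerSeries.mk (g R) := by
      ext m
      simp [sigma, gHom_S]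
    have hg := mk_g_eq R n
    rw [Finset.sum_range_succ, Nat.sub_self, coeff_zero_pow (by simp [g_zero]), mul_one] at hg
    rw [KSym_eq, map_sub, gHom_S, map_sum, hg, sub_eq_iff_eq_add, add_comm, add_right_inj]
    refine Finset.sum_congr rfl fun j hj => ?_
    rw [map_mul, ih j (Finset.mem_range.mp hj), ← hm, ← map_pow, PowerSeries.coeff_map]
    rfl

theorem KHom_g (n : ℕ) : KHom R (g R n) = S R n := by
  have : PowerSeries.map (KHom R : NSym R →+* NSym R) (PowerSeries.mk (g R)) = sigma R := by
    apply lagrange_unique (KSym R) 1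
    · simp [g_zero]
    · simp [sigma, S_zero]
    · intro n
      rw [PowerSeries.coeff_map, PowerSeries.coeff_mk, mk_g_eq, map_sum]
      refine Finset.sum_congr rfl fun j _ => ?_
      rw [map_mul, one_mul, ← map_pow, PowerSeries.coeff_map]
      simp [KHom_S]
    · intro n
      simp only [one_mul]
      rw [← S_eq_KSym]
      simp [sigma]
  simpa [sigma] using congrArg (PowerSeries.coeff n) this

/-- The algebra automorphism `S_n ↦ g_n` of `Sym`. -/
def gEquiv : NSym R ≃ₐ[R] NSym R :=
  AlgEquiv.ofAlgHom (gHom R) (KHom R)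
    (algHom_ext_S fun n => by simp [KHom_S, gHom_KSym])
    (algHom_ext_S fun n => by simp [gHom_S, KHom_g])

theorem gEquiv_S (n : ℕ) : gEquiv R (S R n) = g R n := gHom_S R n

/-- The tilde automorphism of `Sym`, defined by `Λ_n ↦ g_n`. -/
def tilde : NSym R ≃ₐ[R] NSym R := (lamEquiv R).symm.trans (gEquiv R)

theorem tilde_Lam (n : ℕ) : tilde R (Lam R n) = g R n := by
  rw [tilde, AlgEquiv.trans_apply, ← lamEquiv_S, AlgEquiv.symm_apply_apply, gEquiv_S]

/-! ### Multiplicative bases -/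

/-- The product `S_{l_1} S_{l_2} ⋯` along a list. -/
def SProd (l : List ℕ) : NSym R := (l.map (S R)).prod

/-- A composition as a word over the positive integers. -/
def word {n : ℕ} (I : Composition n) : FreeMonoid ℕ+ :=
  FreeMonoid.ofList (I.blocks.pmap (fun i h => i.toPNat h) fun _ h => I.blocks_pos h)

/-- The word over the positive integers, as a list of natural numbers. -/
def parts (w : FreeMonoid ℕ+) : List ℕ := List.map PNat.val (FreeMonoid.toList w)

theorem parts_word {n : ℕ} (I : Composition n) : parts (word I) = I.blocks := by
  rw [parts, word, FreeMonoid.toList_ofList]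
  apply List.ext_getElem
  · simp
  · intro i h1 h2
    rw [List.getElem_map, List.getElem_pmap]
    rfl

/-- The basis `S^I` of `Sym`. -/
def SBasis : Module.Basis (FreeMonoid ℕ+) R (NSym R) := FreeAlgebra.basisFreeMonoid R ℕ+

theorem SBasis_apply (w : FreeMonoid ℕ+) : SBasis R w = SProd R (parts w) := by
  have h : SBasis R w = FreeAlgebra.equivMonoidAlgebraFreeMonoid.symm
      (MonoidAlgebra.of R (FreeMonoid ℕ+) w) := by
    simp [SBasis, FreeAlgebra.basisFreeMonoid]
  rw [h]
  clear h
  induction w using FreeMonoid.inductionOn' with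
  | one => 
    rw [map_one, map_one]
    simp [parts, SProd]
  | of_mul k w ih =>
    rw [map_mul, map_mul, ih]
    have : FreeAlgebra.equivMonoidAlgebraFreeMonoid.symm
      (MonoidAlgebra.of R (FreeMonoid ℕ+) (FreeMonoid.of k)) = S R k := by
      rw [S_coe, AlgEquiv.symm_apply_eq]
      simp [FreeAlgebra.equivMonoidAlgebraFreeMonoid]
    rw [this]
    simp [parts, SProd]

/-- The basis `g^I = g_{i_1} ⋯ g_{i_r}` of `Sym`. -/
def gBasis : Module.Basis (FreeMonoid ℕ+) R (NSym R) := (SBasis R).map (gEquiv R).toLinearEquiv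

/-- The basis `Λ^I = Λ_{i_1} ⋯ Λ_{i_r}` of `Sym`. -/
def LamBasis : Module.Basis (FreeMonoid ℕ+) R (NSym R) :=
  (SBasis R).map (lamEquiv R).toLinearEquiv

/-- The product `g^I = g_{i_1} ⋯ g_{i_r}`. -/
def gProd {n : ℕ} (I : Composition n) : NSym R := (I.blocks.map (g R)).prod

theorem gBasis_apply (w : FreeMonoid ℕ+) : gBasis R w = ((parts w).map (g R)).prod := by
  rw [gBasis, Module.Basis.map_apply, SBasis_apply]
  simp [SProd, map_list_prod, Function.comp_def, gEquiv_S]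

theorem LamBasis_apply (w : FreeMonoid ℕ+) : LamBasis R w = ((parts w).map (Lam R)).prod := by
  rw [LamBasis, Module.Basis.map_apply, SBasis_apply]
  simp [SProd, map_list_prod, Function.comp_def, lamEquiv_S]

theorem gBasis_word {n : ℕ} (I : Composition n) : gBasis R (word I) = gProd R I := by
  rw [gBasis_apply, parts_word, gProd]

/-- The linear map `g^I ↦ g^{Ī}`, where `Ī` is the mirror image of `I`. -/
def chi : NSym R →ₗ[R] NSym R := (gBasis R).constr R fun w => gBasis R w.reverse

/-! ### Homogeneity -/

theorem parts_mul (w w' : FreeMonoid ℕ+) : parts (w * w') = parts w ++ parts w' := by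
  simp [parts]

/-- The homogeneous component of degree `n` of `Sym`. -/
def homog (n : ℕ) : Submodule R (NSym R) :=
  Submodule.span R (SBasis R '' {w | (parts w).sum = n})

variable {R}

theorem SBasis_mul (w w' : FreeMonoid ℕ+) : SBasis R w * SBasis R w' = SBasis R (w * w') := by
  simp [SBasis_apply, parts_mul, SProd]

theorem homog_mul {m n : ℕ} {x y : NSym R} (hx : x ∈ homog R m) (hy : y ∈ homog R n) :
    x * y ∈ homog R (m + n) := by
  have := Submodule.mul_mem_mul hx hy
  rw [homog, homog, Submodule.span_mul_span] at this
  refine Submodule.span_mono ?_ this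
  rintro _ ⟨_, ⟨w, hw, rfl⟩, _, ⟨w', hw', rfl⟩, rfl⟩
  refine ⟨w * w', ?_, (SBasis_mul w w').symm⟩
  simp only [Set.mem_ofPred_eq] at *
  simp [parts_mul, hw, hw']

theorem homog_one : (1 : NSym R) ∈ homog R 0 := by
  refine Submodule.subset_span ⟨1, ?_, ?_⟩
  · simp [parts]
  · simp [SBasis_apply, parts, SProd]

theorem homog_S (n : ℕ) : S R n ∈ homog R n := by
  cases n with
  | zero => simpa [S_zero] using homog_one
  | succ n =>
    refine Submodule.subset_span ⟨FreeMonoid.of n.succPNat, ?_, ?_⟩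
    · simp [parts]
    · simp [SBasis_apply, parts, SProd]

theorem homog_neg_one_pow (k : ℕ) {n : ℕ} {x : NSym R} (hx : x ∈ homog R n) :
    (-1) ^ k * x ∈ homog R n := by
  rcases neg_one_pow_eq_or (NSym R) k with h | h
  · simpa [h] using hx
  · simpa [h] using hx

theorem homog_coeff_pow {F : PowerSeries (NSym R)} {N : ℕ}
    (h : ∀ n ≤ N, PowerSeries.coeff n F ∈ homog R n) (k : ℕ) :
    ∀ n ≤ N, PowerSeries.coeff n (F ^ k) ∈ homog R n := by
  induction k with
  | zero =>
    intro n _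
    rw [pow_zero, PowerSeries.coeff_one]
    split_ifs with h0
    · subst h0; exact homog_one
    · exact Submodule.zero_mem _
  | succ k ih =>
    intro n hn
    rw [pow_succ, PowerSeries.coeff_mul]
    refine Submodule.sum_mem _ fun p hp => ?_
    have hp := Finset.HasAntidiagonal.mem_antidiagonal.mp hp
    rw [← hp]
    exact homog_mul (ih _ (by omega)) (h _ (by omega))

theorem homog_Sneg (n : ℕ) : Sneg R n ∈ homog R n := by
  induction n using Nat.strong_induction_on with
  | _ n ih =>
    rcases Nat.eq_zero_or_pos n with rfl | hn
    · simpa [Sneg_zero] using homog_one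
    · have h := sum_S_Sneg R n
      rw [if_neg (by omega), Finset.Nat.sum_antidiagonal_eq_sum_range_succ_mk,
        Finset.sum_range_succ'] at h
      simp only [S_zero, one_mul, Nat.sub_zero] at h
      rw [eq_neg_of_add_eq_zero_right h]
      refine Submodule.neg_mem _ (Submodule.sum_mem _ fun j hj => ?_)
      have hj := Finset.mem_range.mp hj
      have := homog_mul (homog_S (R := R) (j + 1)) (ih (n - (j + 1)) (by omega))
      rwa [show j + 1 + (n - (j + 1)) = n by omega] at this

theorem homog_Lam (n : ℕ) : Lam R n ∈ homog R n := by
  rw [Lam, ← Sneg_eq]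
  exact homog_neg_one_pow _ (homog_Sneg n)

theorem homog_KSym (n : ℕ) : KSym R n ∈ homog R n := by
  induction n using Nat.strong_induction_on with
  | _ n ih =>
    rw [KSym_eq]
    refine Submodule.sub_mem _ (homog_S n) (Submodule.sum_mem _ fun j hj => ?_)
    have hj := Finset.mem_range.mp hj
    have := homog_mul (ih j hj) (homog_coeff_pow (N := n - j) (F := sigma R)
      (fun m _ => by simpa [sigma] using homog_S m) j (n - j) le_rfl)
    rwa [show j + (n - j) = n by omega] at this

theorem homog_SProd (f : NSym R →ₐ[R] NSym R) (hf : ∀ n, f (S R n) ∈ homog R n) (l : List ℕ) :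
    f (SProd R l) ∈ homog R l.sum := by
  induction l with
  | nil => simpa [SProd] using homog_one
  | cons k l ih =>
    have := homog_mul (hf k) ih
    simpa [SProd] using this

theorem repr_eq_zero_of_homog {n : ℕ} {x : NSym R} (hx : x ∈ homog R n) {w : FreeMonoid ℕ+}
    (hw : (parts w).sum ≠ n) : (SBasis R).repr x w = 0 := by
  have := (SBasis R).mem_span_image.mp hx
  by_contra h
  exact hw (this (Finsupp.mem_support_iff.mpr h))

variable (R)

/-! ### Quasi-symmetric functions -/

/-- The nonzero exponents of a monomial in `x_0, x_1, x_2, …`, in increasing order of the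
variables. -/
def exps (m : ℕ →₀ ℕ) : List ℕ := (m.support.sort (· ≤ ·)).map m

/-- `QSym`: the formal power series of bounded degree in `x_0, x_1, x_2, …` in which two monomials
with the same sequence of nonzero exponents have the same coefficient. -/
def QSym : Submodule R (MvPowerSeries ℕ R) where
  carrier := {F | (∃ d, ∀ m : ℕ →₀ ℕ, d < m.degree → MvPowerSeries.coeff m F = 0) ∧
    ∀ m m' : ℕ →₀ ℕ, exps m = exps m' → MvPowerSeries.coeff m F = MvPowerSeries.coeff m' F}
  zero_mem' := ⟨⟨0, by simp⟩, by simp⟩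
  add_mem' := by
    rintro F G ⟨⟨d, hd⟩, hF⟩ ⟨⟨e, he⟩, hG⟩
    refine ⟨⟨max d e, fun m hm => ?_⟩, fun m m' h => ?_⟩
    · rw [map_add, hd m (lt_of_le_of_lt (le_max_left _ _) hm),
        he m (lt_of_le_of_lt (le_max_right _ _) hm), add_zero]
    · rw [map_add, map_add, hF m m' h, hG m m' h]
  smul_mem' := by
    rintro r F ⟨⟨d, hd⟩, hF⟩
    refine ⟨⟨d, fun m hm => ?_⟩, fun m m' h => ?_⟩
    · rw [map_smul, hd m hm, smul_zero]
    · rw [map_smul, map_smul, hF m m' h]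

theorem sum_exps (m : ℕ →₀ ℕ) : (exps m).sum = m.degree := by
  have h := Finset.sum_map_toList m.support m
  have hp := (Finset.sort_perm_toList m.support (· ≤ ·)).map m
  rw [exps, hp.sum_eq, h]
  rfl

theorem exps_toFinsupp (w : FreeMonoid ℕ+) : exps (parts w).toFinsupp = parts w := by
  have hpos : ∀ i, (h : i < (parts w).length) → (parts w)[i] ≠ 0 := by
    intro i h
    simp [parts]
  have hs : (parts w).toFinsupp.support = Finset.range (parts w).length := by
    ext i
    rw [List.toFinsupp_support, Finset.mem_filter]
    refine ⟨fun h => h.1, fun h => ⟨h, ?_⟩⟩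
    have hi := Finset.mem_range.mp h
    rw [List.getD_eq_getElem _ _ hi]
    exact hpos i hi
  rw [exps, hs, Finset.sort_range]
  apply List.ext_getElem
  · simp
  · intro i h1 h2
    simp [List.getElem?_eq_getElem h2]

variable {R} in
/-- The pairing `QSym × Sym → R`: the pairing of `F` with `S^I` is the coefficient in `F` of
`x_0^{i_1} x_1^{i_2} ⋯ x_{r-1}^{i_r}`, that is, the coefficient of `F` on the monomial function
`M_I`. -/
def pairing (F : QSym R) : NSym R →ₗ[R] R :=
  (SBasis R).constr R fun w => MvPowerSeries.coeff (parts w).toFinsupp (F : MvPowerSeries ℕ R)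

/-- The monomial quasi-symmetric function `M_I`, the sum of all monomials
`x_{k_1}^{i_1} ⋯ x_{k_r}^{i_r}` with `k_1 < ⋯ < k_r`. -/
def M {n : ℕ} (I : Composition n) : QSym R :=
  ⟨fun m => if exps m = I.blocks then 1 else 0, by
    refine ⟨⟨n, fun m hm => ?_⟩, fun m m' h => ?_⟩
    · refine if_neg fun h => ?_
      rw [← sum_exps, h, I.blocks_sum] at hm
      exact lt_irrefl _ hm
    · change (if _ then _ else _) = (if _ then _ else _)
      rw [h]⟩

/-- For a degree-preserving automorphism `e` of `Sym`, the element of `QSym` whose pairing with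
`e(S^J)` is `1` if `J = I` and `0` otherwise: its coefficient on `M_J` is the coefficient of
`e(S^I)` in the expansion of `S^J`. -/
def dual (e : NSym R ≃ₐ[R] NSym R) (he : ∀ n, e.symm (S R n) ∈ homog R n) {n : ℕ}
    (I : Composition n) : QSym R :=
  ⟨fun m => ((SBasis R).map e.toLinearEquiv).repr (SProd R (exps m)) (word I), by
    refine ⟨⟨n, fun m hm => ?_⟩, fun m m' h => ?_⟩
    · change (SBasis R).repr (e.symm (SProd R (exps m))) (word I) = 0
      refine repr_eq_zero_of_homog (homog_SProd e.symm.toAlgHom he (exps m)) ?_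
      rw [parts_word, I.blocks_sum, sum_exps]
      exact hm.ne
    · change ((SBasis R).map e.toLinearEquiv).repr (SProd R (exps m)) (word I) =
        ((SBasis R).map e.toLinearEquiv).repr (SProd R (exps m')) (word I)
      rw [h]⟩

/-- The basis `c_I` of `QSym` dual to the basis `g^I` of `Sym`. -/
def c {n : ℕ} (I : Composition n) : QSym R :=
  dual R (gEquiv R) (fun n => by
    change KHom R (S R n) ∈ _
    rw [KHom_S]
    exact homog_KSym n) I

/-- The basis `V_I` of `QSym` dual to the basis `Λ^I` of `Sym`. -/
def V {n : ℕ} (I : Composition n) : QSym R :=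
  dual R (lamEquiv R) (fun n => by
    change lamHom R (S R n) ∈ _
    rw [lamHom_S]
    exact homog_Lam n) I

theorem pairing_dual (e : NSym R ≃ₐ[R] NSym R) (he : ∀ n, e.symm (S R n) ∈ homog R n) {n : ℕ}
    (I : Composition n) (x : NSym R) :
    pairing (dual R e he I) x = ((SBasis R).map e.toLinearEquiv).repr x (word I) := by
  have : pairing (dual R e he I) =
      (Finsupp.lapply (word I)).comp ((SBasis R).map e.toLinearEquiv).repr.toLinearMap := by
    refine (SBasis R).ext fun w => ?_
    rw [pairing, Module.Basis.constr_basis, SBasis_apply]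
    change ((SBasis R).map e.toLinearEquiv).repr (SProd R (exps (parts w).toFinsupp)) (word I) = _
    rw [exps_toFinsupp]
    rfl
  rw [this]
  rfl

/-- Pairing with `c_I` extracts the coefficient of `g^I`. -/
theorem pairing_c {n : ℕ} (I : Composition n) (x : NSym R) :
    pairing (c R I) x = (gBasis R).repr x (word I) := pairing_dual R _ _ I x

/-- Pairing with `V_I` extracts the coefficient of `Λ^I`. -/
theorem pairing_V {n : ℕ} (I : Composition n) (x : NSym R) :
    pairing (V R I) x = (LamBasis R).repr x (word I) := pairing_dual R _ _ I x

/-- Pairing with `M_I` extracts the coefficient of `S^I`. -/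
theorem pairing_M {n : ℕ} (I : Composition n) (x : NSym R) :
    pairing (M R I) x = (SBasis R).repr x (word I) := by
  have : pairing (M R I) = (Finsupp.lapply (word I)).comp (SBasis R).repr.toLinearMap := by
    refine (SBasis R).ext fun w => ?_
    rw [pairing, Module.Basis.constr_basis]
    change (if exps (parts w).toFinsupp = I.blocks then (1 : R) else 0) =
      (SBasis R).repr (SBasis R w) (word I)
    classical
    rw [exps_toFinsupp, Module.Basis.repr_self, ← parts_word, Finsupp.single_apply]
    have hinj : parts w = parts (word I) ↔ w = word I :=
      (List.map_injective_iff.mpr PNat.coe_injective).eq_iff.trans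
        FreeMonoid.toList.injective.eq_iff
    simp only [hinj]
  rw [this]
  rfl

end

/-! ### Nondecreasing parking functions and parking quasi-ribbons -/

/-- Nondecreasing parking functions of length `n`: nondecreasing words `a_1 ⋯ a_n` of positive
integers with `a_i ≤ i`. Positions and letters are numbered from `0` here. -/
def IsNDPF {n : ℕ} (a : Fin n → Fin n) : Prop := Monotone a ∧ ∀ i, a i ≤ i

/-- The type (packed evaluation) of a word: the nonzero multiplicities of the letters, in
increasing order of the letters. -/
def wordType {n : ℕ} (a : Fin n → Fin n) : List ℕ :=
  (List.ofFn fun v => (Finset.univ.filter fun i => a i = v).card).filter (· ≠ 0)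

/-- The number of nondecreasing parking functions of type `J`. -/
noncomputable def numNDPF {n : ℕ} (J : Composition n) : ℕ :=
  Nat.card {a : Fin n → Fin n // IsNDPF a ∧ wordType a = J.blocks}

/-- The conjugate composition `I^∼`: its descent set is the mirror image of the complement of the
descent set of `I`. -/
def conj {n : ℕ} (I : Composition n) : Composition n :=
  CompositionAsSet.toComposition
    { boundaries := Finset.univ.filter fun j => j = 0 ∨ j = Fin.last n ∨ j.rev ∉ I.boundaries
      zero_mem := by simp
      getLast_mem := by simp }

/-- Parking quasi-ribbons of shape `I`: nondecreasing parking functions written in the ribbon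
diagram of shape `I`, so that a strict increase takes place at each descent of `I`. -/
def IsParkingQuasiRibbon {n : ℕ} (I : Composition n) (a : Fin n → Fin n) : Prop :=
  IsNDPF a ∧ ∀ i j : Fin n, (j : ℕ) = i + 1 → j.castSucc ∈ I.boundaries → a i < a j

/-- For `J = (j_1, …, j_r)`, the number of sequences of parking quasi-ribbons of respective shapes
`I_1^∼, …, I_r^∼`, where each `I_k` is a composition of `j_k` and `I` is the concatenation
`I_1 ⋯ I_r`. It is `0` if `I` does not refine `J`. -/
noncomputable def numQuasiRibbons {n : ℕ} (I J : Composition n) : ℕ :=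
  Nat.card {T : (k : Fin J.length) → Σ K : Composition (J.blocksFun k),
      {a : Fin (J.blocksFun k) → Fin (J.blocksFun k) // IsParkingQuasiRibbon (conj K) a} //
    (List.ofFn fun k => (T k).1.blocks).flatten = I.blocks}

end LagrangeSym

open LagrangeSym

/-! Write σ = ∑ S_n t^n, λ = ∑ Λ_n t^n, and let φ be the morphism S_n ↦ g_n. For K ⊨ n the antipode
sends S^K to (-1)^n Λ^{K̄}. Once the tilde map is known to send g_k back to Λ_k (`tilde_g`), Λ^{K̄}
is the tilde of χ(g^K) = χ(φ(S^K)), so in degree n the antipode is (-1)^n tilde ∘ χ ∘ φ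
(`anti_eq_of_homog`). Together with φ(g_n) = g_n^{(2)} (`gHom_g`) this is the first claim. The
second follows because tilde carries Λ^I to g^I (`repr_tilde`) and χ(φ(g_n)) = ∑_J ⟨M_{J̄}, g_n⟩
g^J.

`tilde_g` and `gHom_g` come from functional equations. For a fixed series u, `rightEval` lets a
series a act on b by ∑ a_j t^j b u^j; left and right multiplications commute, so a product acts as a
composition (`rightEval_mul`). A series satisfying a Lagrange equation is then identified by
uniqueness of the solution (`eq_lagrangeSeries`).

The coefficients of g_n on S^I and on Λ^I obey one recursion over the powers of a series F, namely
F^{k+1} = F^k + ∑_{j ≥ 1} ε^{j-1} S_j t^j F^{k+j+m}, with (ε, m) = (1, 0) for g and (-1, 1) for its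
image under S_n ↦ Λ_n. Its solution is the number `wt m` up to the sign ε^{n-ℓ(I)}
(`repr_coeff_pow`).

These numbers count nondecreasing parking functions by transfer operators on the difference i - a_i.
`wt 0` imposes equality inside the blocks of I and a strict rise between blocks, which prescribes
the type. `wt 1` imposes equality inside the blocks and only a weak increase between them.
Quasi-ribbons of shape I^∼ carry the mirrored constraints with strict rises in place of equalities;
the counts agree by `run_reverse_swap`, since the operators of equality and strict rise are
transposes of each other for the symmetric kernel binom(s+t, t). -/

namespace LagrangeSym

/-! ### Evaluation of noncommutative series with coefficients on the left -/

section RightEval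

variable {A : Type*} [Ring A]

open Finset.HasAntidiagonal (antidiagonal)
open PowerSeries (coeff mk)

theorem sum_antidiagonal_assoc {B : Type*} [AddCommMonoid B] (n : ℕ) (f : ℕ → ℕ → ℕ → B) :
    ∑ p ∈ antidiagonal n, ∑ q ∈ antidiagonal p.1, f q.1 q.2 p.2 =
      ∑ p ∈ antidiagonal n, ∑ q ∈ antidiagonal p.2, f p.1 q.1 q.2 := by
  rw [Finset.sum_sigma', Finset.sum_sigma']
  refine Finset.sum_nbij' (fun x => ⟨(x.2.1, x.2.2 + x.1.2), (x.2.2, x.1.2)⟩)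
    (fun x => ⟨(x.1.1 + x.2.1, x.2.2), (x.1.1, x.2.1)⟩) ?_ ?_ ?_ ?_ ?_
  all_goals
    rintro ⟨⟨a, b⟩, ⟨c, d⟩⟩ h
    simp only [Finset.mem_sigma, Finset.HasAntidiagonal.mem_antidiagonal] at h ⊢
  · exact ⟨by omega, trivial⟩
  · exact ⟨by omega, trivial⟩
  · obtain ⟨-, rfl⟩ := h
    rfl
  · obtain ⟨-, rfl⟩ := h
    rfl

/-- The series `∑ a_j t^j b u^j`: the series `a` evaluated at `u`, with the coefficients of `a` on
the left, acting on `b`. -/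
noncomputable def rightEval (a b u : PowerSeries A) : PowerSeries A :=
  mk fun n => ∑ p ∈ antidiagonal n, coeff p.1 a * coeff p.2 (b * u ^ p.1)

theorem coeff_rightEval (a b u : PowerSeries A) (n : ℕ) :
    coeff n (rightEval a b u) =
      ∑ p ∈ antidiagonal n, coeff p.1 a * coeff p.2 (b * u ^ p.1) := by
  rw [rightEval, PowerSeries.coeff_mk]

/-- Right multiplication by `c` always commutes with the left multiplications by the coefficients of
`a`; the hypothesis lets it pass through the right multiplications by powers of `u` as well. -/
theorem rightEval_mul_right (a b u c : PowerSeries A) (h : Commute c u) :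
    rightEval a (b * c) u = rightEval a b u * c := by
  ext n
  rw [coeff_rightEval, PowerSeries.coeff_mul]
  simp only [coeff_rightEval, Finset.sum_mul]
  rw [sum_antidiagonal_assoc n
    (fun i l s => coeff i a * coeff l (b * u ^ i) * coeff s c)]
  refine Finset.sum_congr rfl fun p _ => ?_
  rw [mul_assoc, (h.pow_right p.1).eq, ← mul_assoc, PowerSeries.coeff_mul, Finset.mul_sum]
  simp only [mul_assoc]

/-- Evaluation at `u` is not multiplicative over a noncommutative ring. What survives is an action:
coefficients multiply on the left, `u` on the right, and these operations commute. -/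
theorem rightEval_mul (a a' b u : PowerSeries A) :
    rightEval (a * a') b u = rightEval a (rightEval a' b u) u := by
  ext n
  rw [coeff_rightEval, coeff_rightEval]
  have h : ∀ p ∈ antidiagonal n, coeff p.1 (a * a') * coeff p.2 (b * u ^ p.1) =
      ∑ q ∈ antidiagonal p.1, coeff q.1 a * coeff q.2 a' * coeff p.2 (b * u ^ (q.1 + q.2)) := by
    intro p _
    rw [PowerSeries.coeff_mul p.1, Finset.sum_mul]
    refine Finset.sum_congr rfl fun q hq => ?_
    rw [Finset.HasAntidiagonal.mem_antidiagonal.mp hq]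
  rw [Finset.sum_congr rfl h,
    sum_antidiagonal_assoc n (fun i j l => coeff i a * coeff j a' * coeff l (b * u ^ (i + j)))]
  refine Finset.sum_congr rfl fun p _ => ?_
  rw [← rightEval_mul_right a' b u _ ((Commute.refl u).pow_left _),
    coeff_rightEval, Finset.mul_sum]
  refine Finset.sum_congr rfl fun q _ => ?_
  rw [pow_add]
  simp only [mul_assoc]

theorem rightEval_one (b u : PowerSeries A) : rightEval 1 b u = b := by
  ext n
  rw [coeff_rightEval, Finset.sum_eq_single (0, n)]
  · simp
  · rintro ⟨i, j⟩ h hne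
    have : i ≠ 0 := by
      rintro rfl
      simp_all
    simp [PowerSeries.coeff_one, this]
  · simp

/-- Associativity of substitution: evaluating ∑ a_i t^i v^i at `u` turns each v^i into its own
evaluation, and the factor t^i contributes u^i on the right. -/
theorem coeff_rightEval_rightEval (a v u : PowerSeries A) (n : ℕ) :
    coeff n (rightEval (rightEval a 1 v) 1 u) =
      ∑ p ∈ antidiagonal n, coeff p.1 a * coeff p.2 (rightEval (v ^ p.1) 1 u * u ^ p.1) := by
  rw [coeff_rightEval]
  simp only [coeff_rightEval a, one_mul, Finset.sum_mul]
  rw [← Finset.sum_congr rfl fun p hp => Finset.sum_congr rfl fun q hq => by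
    rw [← Finset.HasAntidiagonal.mem_antidiagonal.mp hq],
    sum_antidiagonal_assoc n (fun i j l => coeff i a * coeff j (v ^ i) * coeff l (u ^ (i + j)))]
  refine Finset.sum_congr rfl fun p _ => ?_
  rw [← rightEval_mul_right _ _ u _ ((Commute.refl u).pow_left _), coeff_rightEval, Finset.mul_sum]
  refine Finset.sum_congr rfl fun q _ => ?_
  rw [pow_add, one_mul, mul_assoc]

theorem coeff_mul_congr {b b' c c' : PowerSeries A} {n : ℕ}
    (h : ∀ m ≤ n, coeff m b = coeff m b') (h' : ∀ m ≤ n, coeff m c = coeff m c') :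
    ∀ m ≤ n, coeff m (b * c) = coeff m (b' * c') := by
  intro m hm
  rw [PowerSeries.coeff_mul, PowerSeries.coeff_mul]
  refine Finset.sum_congr rfl fun p hp => ?_
  have := Finset.HasAntidiagonal.mem_antidiagonal.mp hp
  rw [h _ (by omega), h' _ (by omega)]

theorem coeff_rightEval_congr (a u : PowerSeries A) {b b' : PowerSeries A} {n : ℕ}
    (h : ∀ m ≤ n, coeff m b = coeff m b') :
    ∀ m ≤ n, coeff m (rightEval a b u) = coeff m (rightEval a b' u) := by
  intro m hm
  rw [coeff_rightEval, coeff_rightEval]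
  refine Finset.sum_congr rfl fun p hp => ?_
  have := Finset.HasAntidiagonal.mem_antidiagonal.mp hp
  rw [coeff_mul_congr h (fun _ _ => rfl) _ (by omega)]

theorem lagrangeSeries_eq_rightEval (a : ℕ → A) (h0 : a 0 = 1) (k : ℕ) :
    lagrangeSeries a k = rightEval (mk a) 1 (lagrangeSeries a k ^ k) := by
  ext n
  rw [lagrangeSeries_eq a h0, coeff_rightEval, Finset.Nat.sum_antidiagonal_eq_sum_range_succ_mk]
  simp [pow_mul]

/-- The constant term of `F` needs no separate hypothesis: the equation in degree 0 forces it to be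
`a 0 = 1`. -/
theorem eq_lagrangeSeries {a : ℕ → A} (h0 : a 0 = 1) {k : ℕ} {F : PowerSeries A}
    (hF : F = rightEval (mk a) 1 (F ^ k)) : F = lagrangeSeries a k := by
  have hF' : ∀ n, coeff n F = ∑ j ∈ Finset.range (n + 1),
      a j * coeff (n - j) (F ^ (k * j)) := by
    intro n
    conv_lhs => rw [hF]
    rw [coeff_rightEval, Finset.Nat.sum_antidiagonal_eq_sum_range_succ_mk]
    simp [pow_mul]
  refine lagrange_unique a k F _ ?_ ?_ hF' (lagrangeSeries_eq a h0 k)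
  · simpa [h0] using hF' 0
  · simp [lagrangeSeries, lagrangeCoeff_zero]

theorem map_rightEval {B : Type*} [Ring B] (f : A →+* B) (a b u : PowerSeries A) :
    PowerSeries.map f (rightEval a b u) =
      rightEval (PowerSeries.map f a) (PowerSeries.map f b) (PowerSeries.map f u) := by
  ext n
  simp only [PowerSeries.coeff_map, coeff_rightEval, map_sum, map_mul f, ← map_pow, ← map_mul (PowerSeries.map f)]

/-- The substitution `t ↦ -t`. -/
noncomputable def negVar (a : PowerSeries A) : PowerSeries A := mk fun n => (-1) ^ n * coeff n a

theorem coeff_negVar (a : PowerSeries A) (n : ℕ) : coeff n (negVar a) = (-1) ^ n * coeff n a := by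
  rw [negVar, PowerSeries.coeff_mk]

theorem negVar_one : negVar (1 : PowerSeries A) = 1 := by
  ext n
  rw [coeff_negVar, PowerSeries.coeff_one]
  split_ifs with h <;> simp [h]

theorem neg_one_pow_mul_mul (i j : ℕ) (x y : A) :
    (-1) ^ (i + j) * (x * y) = (-1) ^ i * x * ((-1) ^ j * y) := by
  have hc : Commute ((-1 : A) ^ j) x := ((Commute.one_left _).neg_left).pow_left j
  rw [pow_add, mul_assoc, mul_assoc, ← mul_assoc _ x y, hc.eq, mul_assoc]

theorem negVar_mul (a b : PowerSeries A) : negVar (a * b) = negVar a * negVar b := by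
  ext n
  simp only [coeff_negVar, PowerSeries.coeff_mul, Finset.mul_sum]
  refine Finset.sum_congr rfl fun p hp => ?_
  rw [← Finset.HasAntidiagonal.mem_antidiagonal.mp hp, neg_one_pow_mul_mul]

theorem negVar_pow (a : PowerSeries A) (k : ℕ) : negVar (a ^ k) = negVar a ^ k := by
  induction k with
  | zero => simp [negVar_one]
  | succ k ih => rw [pow_succ, pow_succ, negVar_mul, ih]

theorem negVar_rightEval (a b u : PowerSeries A) :
    negVar (rightEval a b u) = rightEval (negVar a) (negVar b) (negVar u) := by
  ext n
  simp only [← negVar_pow, ← negVar_mul, coeff_rightEval, coeff_negVar, Finset.mul_sum]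
  refine Finset.sum_congr rfl fun p hp => ?_
  rw [← Finset.HasAntidiagonal.mem_antidiagonal.mp hp, neg_one_pow_mul_mul]

end RightEval

/-! ### The images of g_n under S_n ↦ g_n and under the tilde automorphism -/

section Tilde

open PowerSeries (coeff mk)

variable (R : Type*) [CommRing R]

theorem mk_g_eq_rightEval : mk (g R) = rightEval (sigma R) 1 (mk (g R)) := by
  have := lagrangeSeries_eq_rightEval (S R) (S_zero R) 1
  rwa [pow_one] at this

theorem map_gHom_sigma :
    PowerSeries.map (gHom R : NSym R →+* NSym R) (sigma R) = mk (g R) := by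
  ext n
  simp [sigma, gHom_S]

/-- Applying S_n ↦ g_n to the equation of g shows that the image G is g evaluated at G. Expanding
that g by its own equation gives ∑ S_i t^i G^i G^i, the equation of the 2-Lagrange series. -/
theorem gHom_g (n : ℕ) : gHom R (g R n) = g2 R n := by
  set G := PowerSeries.map (gHom R : NSym R →+* NSym R) (mk (g R)) with hG
  have h1 : G = rightEval (mk (g R)) 1 G := by
    conv_lhs => rw [hG, mk_g_eq_rightEval, map_rightEval, map_gHom_sigma, map_one, ← hG]
  -- Evaluation at G is multiplicative on powers of g, because the value G of g commutes with the
  -- evaluation point G.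
  have h2 : ∀ j, rightEval (mk (g R) ^ j) 1 G = G ^ j := by
    intro j
    induction j with
    | zero => rw [pow_zero, pow_zero, rightEval_one]
    | succ j ih =>
      rw [pow_succ', rightEval_mul, ih, pow_succ']
      conv_rhs => rw [h1]
      have := rightEval_mul_right (mk (g R)) 1 G (G ^ j) ((Commute.refl G).pow_left _)
      rw [one_mul] at this
      rw [this, ← h1]
  have h3 : G = lagrangeSeries (S R) 2 := by
    apply eq_lagrangeSeries (S_zero R)
    ext n
    conv_lhs => rw [h1, mk_g_eq_rightEval, coeff_rightEval_rightEval]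
    rw [coeff_rightEval]
    refine Finset.sum_congr rfl fun p _ => ?_
    rw [h2, one_mul, ← pow_mul, two_mul, pow_add]
    rfl
  have := congrArg (coeff n) h3
  simpa [hG, lagrangeSeries, g2] using this

/-- With τ = σ⁻¹, expanding g by its equation writes the value g(τ) as ∑ S_i t^i (g^i)(τ) τ^i. If
g(τ) = σ in lower degrees, then (g^i)(τ) = σ^i there, the factors σ^i τ^i cancel, and ∑ S_i t^i = σ
remains. -/
theorem rightEval_g_Sneg : rightEval (mk (g R)) 1 (mk (Sneg R)) = sigma R := by
  set τ := mk (Sneg R) with hτ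
  have hc : Commute (sigma R) τ := (sigma_mul_Sneg R).trans (Sneg_mul_sigma R).symm
  have hV : ∀ n, coeff n (rightEval (mk (g R)) 1 τ) = ∑ p ∈ Finset.HasAntidiagonal.antidiagonal n,
      S R p.1 * coeff p.2 (rightEval (mk (g R) ^ p.1) 1 τ * τ ^ p.1) := by
    intro n
    conv_lhs => rw [mk_g_eq_rightEval, coeff_rightEval_rightEval]
    simp [sigma]
  have hpow : ∀ n, (∀ m ≤ n, coeff m (rightEval (mk (g R)) 1 τ) = coeff m (sigma R)) →
      ∀ j, ∀ m ≤ n, coeff m (rightEval (mk (g R) ^ j) 1 τ) = coeff m (sigma R ^ j) := by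
    intro n h j
    induction j with
    | zero => simp [rightEval_one]
    | succ j ih =>
      intro m hm
      rw [pow_succ', rightEval_mul, coeff_rightEval_congr _ _ ih m hm, pow_succ',
        ← coeff_mul_congr h (fun _ _ => rfl) m hm, ← rightEval_mul_right _ _ _ _ (hc.pow_left j),
        one_mul]
  have key : ∀ n, ∀ m < n, coeff m (rightEval (mk (g R)) 1 τ) = coeff m (sigma R) := by
    intro n
    induction n with
    | zero => simp
    | succ n ih =>
      intro m hm
      have h1 : coeff m (sigma R) =
          ∑ p ∈ Finset.HasAntidiagonal.antidiagonal m, S R p.1 * coeff p.2 (1 : PowerSeries (NSym R)) := by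
        have := PowerSeries.coeff_mul m (sigma R) 1
        simpa [sigma] using this
      rw [hV, h1]
      refine Finset.sum_congr rfl fun p hp => ?_
      have hp := Finset.HasAntidiagonal.mem_antidiagonal.mp hp
      rcases Nat.eq_zero_or_pos p.1 with h0 | h0
      · rw [h0]
        simp [rightEval_one]
      -- Since `p.1 > 0`, only degrees at most `n - 1` of the second factor occur, and these are
      -- covered by the induction hypothesis.
      · have := hpow (n - 1) (fun i hi => ih i (by omega)) p.1
        rw [coeff_mul_congr (this) (fun _ _ => rfl) p.2 (by omega), ← hc.mul_pow, hτ,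
          sigma_mul_Sneg, one_pow]
  ext n
  exact key (n + 1) n (by omega)

theorem negVar_mk_Sneg : negVar (mk (Sneg R)) = mk (Lam R) := by
  ext n
  rw [coeff_negVar, PowerSeries.coeff_mk, PowerSeries.coeff_mk, Sneg, ← mul_assoc, ← pow_add,
    ← two_mul]
  simp

/-- Both λ and the tilde of g solve the Lagrange equation with coefficients tilde(S_n). For tilde(g)
this is the image of the equation of g; for λ it is extracted from `rightEval_g_Sneg`. -/
theorem tilde_g (n : ℕ) : tilde R (g R n) = Lam R n := by
  set f : NSym R →+* NSym R := (tilde R : NSym R →+* NSym R) with hf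
  have hfx : ∀ x, f x = tilde R x := fun _ => rfl
  set T := PowerSeries.map f (sigma R) with hT
  -- The tilde of σ · ∑ (-1)^n Λ_n t^n = 1, with t replaced by -t to absorb the signs.
  have hneg : negVar T * mk (g R) = 1 := by
    have h := congrArg (fun x => negVar (PowerSeries.map f x)) (sigma_mul_Sneg R)
    simp only [map_mul, map_one, negVar_mul, negVar_one] at h
    rw [← h]
    congr 1
    ext n
    rw [coeff_negVar, PowerSeries.coeff_map, PowerSeries.coeff_mk, PowerSeries.coeff_mk, hfx, Sneg,
      map_mul, tilde_Lam, map_pow, map_neg, map_one, ← mul_assoc, ← pow_add, ← two_mul]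
    simp
  have hc : Commute (sigma R) (mk (Sneg R)) := (sigma_mul_Sneg R).trans (Sneg_mul_sigma R).symm
  -- Let `hneg` act on 1 with evaluation point σ⁻¹: there g acts on 1 as σ, which commutes with σ⁻¹
  -- and can be pulled out on the right.
  have h1 : rightEval (negVar T) 1 (mk (Sneg R)) * sigma R = 1 := by
    rw [← rightEval_mul_right _ _ _ _ hc, one_mul, ← rightEval_g_Sneg, ← rightEval_mul, hneg,
      rightEval_one]
  have h2 : rightEval (negVar T) 1 (mk (Sneg R)) = mk (Sneg R) :=
    left_inv_eq_right_inv h1 (sigma_mul_Sneg R)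
  have hTT : negVar (negVar T) = T := by
    ext n
    rw [coeff_negVar, coeff_negVar, ← mul_assoc, ← pow_add, ← two_mul]
    simp
  have h3 : mk (Lam R) = rightEval T 1 (mk (Lam R)) := by
    have := congrArg negVar h2
    rw [negVar_rightEval, hTT, negVar_one, negVar_mk_Sneg] at this
    exact this.symm
  have hTm : T = mk fun n => tilde R (S R n) := by
    ext n
    simp [hT, sigma, hfx]
  have h4 : mk (Lam R) = lagrangeSeries (fun n => tilde R (S R n)) 1 := by
    apply eq_lagrangeSeries
    · simp [S_zero]
    · rw [← hTm, pow_one]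
      exact h3
  have h5 : PowerSeries.map f (mk (g R)) = lagrangeSeries (fun n => tilde R (S R n)) 1 := by
    apply eq_lagrangeSeries
    · simp [S_zero]
    · conv_lhs => rw [mk_g_eq_rightEval, map_rightEval, map_one]
      rw [← hTm, pow_one]
  have := congrArg (coeff n) (h5.trans h4.symm)
  simpa [hfx] using this

end Tilde

/-! ### Expansions on the basis S^I of g_n and of its image under S_n ↦ Λ_n -/

section Coefficients

open PowerSeries (coeff mk)

variable {R : Type*} [CommRing R]

theorem parts_injective : Function.Injective parts :=
  (List.map_injective_iff.mpr PNat.coe_injective).comp FreeMonoid.toList.injective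

theorem parts_pos {w : FreeMonoid ℕ+} {i : ℕ} (h : i ∈ parts w) : 0 < i := by
  obtain ⟨k, -, rfl⟩ := List.mem_map.mp h
  exact k.pos

theorem length_le_sum_parts (w : FreeMonoid ℕ+) : (parts w).length ≤ (parts w).sum :=
  List.length_le_sum_of_one_le _ fun _ h => parts_pos h

theorem word_injective {n : ℕ} : Function.Injective (word (n := n)) := by
  intro I J h
  apply Composition.ext
  rw [← parts_word, ← parts_word, h]

theorem exists_word_eq {n : ℕ} {w : FreeMonoid ℕ+} (h : (parts w).sum = n) :
    ∃ K : Composition n, word K = w :=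
  ⟨⟨parts w, parts_pos, h⟩, parts_injective (parts_word _)⟩

theorem sum_parts_word {n : ℕ} (K : Composition n) : (parts (word K)).sum = n := by
  rw [parts_word, K.blocks_sum]

theorem eq_sum_of_homog {n : ℕ} {x : NSym R} (hx : x ∈ homog R n) :
    x = ∑ K : Composition n, (SBasis R).repr x (word K) • SProd R K.blocks := by
  rw [homog] at hx
  induction hx using Submodule.span_induction with
  | mem x h =>
    obtain ⟨w, hw, rfl⟩ := h
    obtain ⟨K, rfl⟩ := exists_word_eq hw
    rw [Finset.sum_eq_single K]
    · rw [Module.Basis.repr_self, Finsupp.single_eq_same, one_smul, SBasis_apply, parts_word]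
    · intro J _ hJ
      rw [Module.Basis.repr_self, Finsupp.single_eq_of_ne (fun h => hJ (word_injective h)), zero_smul]
    · simp
  | zero => simp
  | add x y _ _ hx hy =>
    simp only [map_add, Finsupp.add_apply, add_smul, Finset.sum_add_distrib]
    rw [← hx, ← hy]
  | smul r x _ hx =>
    simp only [map_smul, Finsupp.smul_apply, smul_assoc]
    rw [← Finset.smul_sum, ← hx]

theorem mem_homog_of_repr {n : ℕ} {x : NSym R}
    (h : ∀ w, (parts w).sum ≠ n → (SBasis R).repr x w = 0) : x ∈ homog R n := by
  refine (SBasis R).mem_span_image.mpr fun w hw => ?_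
  by_contra h'
  exact Finsupp.mem_support_iff.mp hw (h w h')

theorem map_mem_homog (f : NSym R →ₐ[R] NSym R) (hf : ∀ n, f (S R n) ∈ homog R n) {n : ℕ}
    {x : NSym R} (hx : x ∈ homog R n) : f x ∈ homog R n := by
  rw [eq_sum_of_homog hx, map_sum]
  refine Submodule.sum_mem _ fun K _ => ?_
  rw [map_smul]
  have := homog_SProd f hf K.blocks
  rw [K.blocks_sum] at this
  exact Submodule.smul_mem _ _ this

theorem S_mul_SBasis (k : ℕ+) (w : FreeMonoid ℕ+) :
    S R k * SBasis R w = SBasis R (FreeMonoid.of k * w) := by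
  rw [← SBasis_mul, SBasis_apply R (FreeMonoid.of k)]
  simp [parts, SProd]

theorem repr_S_mul_of_mul (k i : ℕ+) (x : NSym R) (w : FreeMonoid ℕ+) :
    (SBasis R).repr (S R k * x) (FreeMonoid.of i * w) = if k = i then (SBasis R).repr x w else 0 := by
  have : (Finsupp.lapply (FreeMonoid.of i * w)).comp
      ((SBasis R).repr.toLinearMap.comp (LinearMap.mulLeft R (S R k))) =
      if k = i then (Finsupp.lapply w).comp (SBasis R).repr.toLinearMap else 0 := by
    refine (SBasis R).ext fun v => ?_
    have hinj : FreeMonoid.of i * w = FreeMonoid.of k * v ↔ i = k ∧ w = v := by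
      rw [← FreeMonoid.toList.injective.eq_iff]
      simp
    classical
    split_ifs with h
    · subst h
      simp [S_mul_SBasis, Finsupp.single_apply, hinj, eq_comm]
    · simp [S_mul_SBasis, hinj, eq_comm, h]
  have := LinearMap.congr_fun this x
  split_ifs at this ⊢
  · simpa using this
  · simpa using this

theorem repr_S_mul_one (k : ℕ+) (x : NSym R) : (SBasis R).repr (S R k * x) 1 = 0 := by
  have : (Finsupp.lapply (1 : FreeMonoid ℕ+)).comp
      ((SBasis R).repr.toLinearMap.comp (LinearMap.mulLeft R (S R k))) = 0 := by
    refine (SBasis R).ext fun v => ?_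
    have hinj : (1 : FreeMonoid ℕ+) ≠ FreeMonoid.of k * v := by
      rw [Ne, ← FreeMonoid.toList.injective.eq_iff]
      simp
    classical
    simp [S_mul_SBasis, hinj.symm]
  simpa using LinearMap.congr_fun this x

/-- The numbers with `wt m (j :: J) k = ∑_{i < k} wt m J (i + j + m)` and `wt m [] k = 1`. -/
def wt (m : ℕ) : List ℕ → ℕ → ℕ
  | [], _ => 1
  | j :: J, k => ∑ i ∈ Finset.range k, wt m J (i + j + m)

/-- The expansion on the basis `S^I` of the coefficients of the powers of a series `F` with
`F^{k+1} = F^k + ∑_{j ≥ 1} ε^{j-1} S_j t^j F^{k+j+m}`. -/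
theorem repr_coeff_pow {F : PowerSeries (NSym R)} {ε : R} {m : ℕ}
    (hF : ∀ n k, coeff n (F ^ (k + 1)) = coeff n (F ^ k) + ∑ j ∈ Finset.range n,
      ε ^ j • (S R (j + 1) * coeff (n - (j + 1)) (F ^ (k + (j + 1) + m))))
    (w : FreeMonoid ℕ+) (n k : ℕ) :
    (SBasis R).repr (coeff n (F ^ k)) w =
      if (parts w).sum = n then ε ^ (n - (parts w).length) * (wt m (parts w) k : R) else 0 := by
  have h1 : (1 : NSym R) = SBasis R 1 := by simp [SBasis_apply, parts, SProd]
  have hS : ∀ j : ℕ, S R (j + 1) = S R (j.succPNat : ℕ) := fun _ => rfl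
  -- Outer induction on the word, inner on the exponent: passing from `k` to `k + 1` adds the
  -- summand of index `k` in the definition of `wt`.
  induction w using FreeMonoid.inductionOn' generalizing n k with
  | one =>
    have hp : parts (1 : FreeMonoid ℕ+) = [] := by simp [parts]
    induction k with
    | zero =>
      rw [pow_zero, PowerSeries.coeff_one]
      by_cases h : n = 0
      · subst h
        rw [if_pos rfl, h1, Module.Basis.repr_self]
        simp [hp, wt]
      · rw [if_neg h, hp, if_neg (by simpa using Ne.symm h)]
        simp
    | succ k ih =>
      rw [hF, map_add, Finsupp.add_apply, ih, map_sum, Finsupp.finsetSum_apply,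
        Finset.sum_eq_zero, add_zero]
      · simp [hp, wt]
      · intro j _
        rw [map_smul, Finsupp.smul_apply, hS, repr_S_mul_one, smul_zero]
  | of_mul i w ih =>
    have hp : parts (FreeMonoid.of i * w) = (i : ℕ) :: parts w := by simp [parts]
    rw [hp]
    induction k with
    | zero =>
      rw [pow_zero, PowerSeries.coeff_one]
      have hne : (1 : FreeMonoid ℕ+) ≠ FreeMonoid.of i * w := by
        rw [Ne, ← FreeMonoid.toList.injective.eq_iff]
        simp
      have h0 : (SBasis R).repr (1 : NSym R) (FreeMonoid.of i * w) = 0 := by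
        rw [h1, Module.Basis.repr_self, Finsupp.single_eq_of_ne hne.symm]
      split_ifs <;> simp [h0, wt]
    | succ k ihk =>
      rw [hF, map_add, Finsupp.add_apply, ihk, map_sum, Finsupp.finsetSum_apply]
      have hsum : ∀ j ∈ Finset.range n,
          (SBasis R).repr (ε ^ j • (S R (j + 1) * coeff (n - (j + 1)) (F ^ (k + (j + 1) + m))))
            (FreeMonoid.of i * w) = if j + 1 = i then
              (if (i : ℕ) + (parts w).sum = n then
                ε ^ (n - ((parts w).length + 1)) * (wt m (parts w) (k + i + m) : R) else 0)
              else 0 := by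
        intro j hj
        have hj := Finset.mem_range.mp hj
        rw [map_smul, Finsupp.smul_apply, hS, repr_S_mul_of_mul, ih]
        have hji : j.succPNat = i ↔ j + 1 = i := by
          rw [← PNat.coe_inj]
          rfl
        simp only [hji]
        split_ifs with h1 h2 h3 h3
        · have := length_le_sum_parts w
          rw [smul_eq_mul, ← mul_assoc, ← pow_add, ← h1]
          congr 2
          omega
        · omega
        · omega
        · simp
        · simp
      rw [Finset.sum_congr rfl hsum]
      have hlen : (List.length ((i : ℕ) :: parts w)) = (parts w).length + 1 := rfl
      have hi := i.pos
      rw [List.sum_cons, hlen]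
      by_cases h : (i : ℕ) + (parts w).sum = n
      · simp only [if_pos h]
        -- Only the term whose leading factor is S_i contributes to a word with first letter `i`;
        -- the summation index is `i - 1`.
        rw [Finset.sum_eq_single ((i : ℕ) - 1), if_pos (by omega), ← mul_add]
        · simp [wt, Finset.sum_range_succ]
        · intro j _ hj
          rw [if_neg (by omega)]
        · intro hn
          exact absurd (Finset.mem_range.mpr (by omega)) hn
      · simp [if_neg h]

/-- Multiplying the equation of g on the right by g^k gives g^{k+1} = ∑ S_j t^j g^{k+j}. -/
theorem coeff_g_pow_succ (n k : ℕ) :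
    coeff n (mk (g R) ^ (k + 1)) = coeff n (mk (g R) ^ k) + ∑ j ∈ Finset.range n,
      (1 : R) ^ j • (S R (j + 1) * coeff (n - (j + 1)) (mk (g R) ^ (k + (j + 1) + 0))) := by
  have h : mk (g R) ^ (k + 1) = rightEval (sigma R) (mk (g R) ^ k) (mk (g R)) := by
    have := rightEval_mul_right (sigma R) 1 (mk (g R)) (mk (g R) ^ k)
      ((Commute.refl _).pow_left _)
    rw [one_mul, ← mk_g_eq_rightEval] at this
    rw [this, pow_succ']
  rw [h, coeff_rightEval, Finset.Nat.sum_antidiagonal_eq_sum_range_succ_mk, Finset.sum_range_succ',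
    add_comm]
  congr 1
  · simp [sigma, S_zero]
  · refine Finset.sum_congr rfl fun j _ => ?_
    rw [one_pow, one_smul, add_zero, ← pow_add]
    simp [sigma]

/-- Here G^{k+1} is λ acting on G^k. The inverse of λ is ∑ (-1)^j S_j t^j, so acting with it gives
G^k = ∑ (-1)^j S_j t^j G^{k+1+j}; isolating j = 0 yields the recursion, with an exponent one higher
than for g. -/
theorem coeff_lamHom_g_pow_succ (n k : ℕ) :
    coeff n (mk (fun i => lamHom R (g R i)) ^ (k + 1)) =
      coeff n (mk (fun i => lamHom R (g R i)) ^ k) + ∑ j ∈ Finset.range n,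
        (-1 : R) ^ j • (S R (j + 1) *
          coeff (n - (j + 1)) (mk (fun i => lamHom R (g R i)) ^ (k + (j + 1) + 1))) := by
  set G := mk (fun i => lamHom R (g R i)) with hG
  have hm : PowerSeries.map (lamHom R : NSym R →+* NSym R) (mk (g R)) = G := by
    ext i
    simp [hG]
  have hσ : PowerSeries.map (lamHom R : NSym R →+* NSym R) (sigma R) = mk (Lam R) := by
    ext i
    simp [sigma, lamHom_S]
  have h1 : G = rightEval (mk (Lam R)) 1 G := by
    conv_lhs => rw [← hm, mk_g_eq_rightEval, map_rightEval, hσ, hm, map_one]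
  have h2 : rightEval (mk (Lam R)) (G ^ k) G = G ^ (k + 1) := by
    have := rightEval_mul_right (mk (Lam R)) 1 G (G ^ k) ((Commute.refl _).pow_left _)
    rw [one_mul, ← h1] at this
    rw [this, pow_succ']
  have h3 : G ^ k = rightEval (negVar (sigma R)) (G ^ (k + 1)) G := by
    rw [← h2, ← rightEval_mul, ← negVar_mk_Sneg, ← negVar_mul, sigma_mul_Sneg, negVar_one,
      rightEval_one]
  have h4 : coeff n (G ^ k) = coeff n (rightEval (negVar (sigma R)) (G ^ (k + 1)) G) := by
    rw [← h3]
  rw [h4, coeff_rightEval, Finset.Nat.sum_antidiagonal_eq_sum_range_succ_mk, Finset.sum_range_succ']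
  simp only [coeff_negVar, ← pow_add]
  have h5 : ∀ j ∈ Finset.range n, (-1 : NSym R) ^ (j + 1) * coeff (j + 1) (sigma R) *
      coeff (n - (j + 1)) (G ^ (k + 1 + (j + 1))) =
      -((-1 : R) ^ j • (S R (j + 1) * coeff (n - (j + 1)) (G ^ (k + (j + 1) + 1)))) := by
    intro j _
    rw [Algebra.smul_def, map_pow (algebraMap R (NSym R)), map_neg, map_one, show k + 1 + (j + 1) = k + (j + 1) + 1 by ring,
      pow_succ (-1 : NSym R)]
    simp [sigma, mul_assoc]
  rw [Finset.sum_congr rfl h5]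
  simp [sigma, S_zero]

theorem repr_g (n : ℕ) (w : FreeMonoid ℕ+) : (SBasis R).repr (g R n) w =
    if (parts w).sum = n then (wt 0 (parts w) 1 : R) else 0 := by
  have := repr_coeff_pow (coeff_g_pow_succ (R := R)) w n 1
  simpa using this

theorem repr_lamHom_g (n : ℕ) (w : FreeMonoid ℕ+) : (SBasis R).repr (lamHom R (g R n)) w =
    if (parts w).sum = n then (-1) ^ (n - (parts w).length) * (wt 1 (parts w) 1 : R) else 0 := by
  have := repr_coeff_pow (coeff_lamHom_g_pow_succ (R := R)) w n 1
  rwa [pow_one, PowerSeries.coeff_mk] at this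

theorem homog_g (n : ℕ) : g R n ∈ homog R n :=
  mem_homog_of_repr fun w hw => by rw [repr_g, if_neg hw]

theorem lamHom_g_eq_sum (n : ℕ) : lamHom R (g R n) = ∑ K : Composition n,
    ((-1) ^ (n - K.length) * (wt 1 K.blocks 1 : R)) • SProd R K.blocks := by
  have h : lamHom R (g R n) ∈ homog R n :=
    mem_homog_of_repr fun w hw => by rw [repr_lamHom_g, if_neg hw]
  conv_lhs => rw [eq_sum_of_homog h]
  refine Finset.sum_congr rfl fun K _ => ?_
  rw [repr_lamHom_g, if_pos (sum_parts_word K), parts_word]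

end Coefficients

/-! ### Transfer operators and their mirror symmetry -/

section Runs

/-- A constraint on two consecutive letters of a nondecreasing word. -/
inductive Step
  | level
  | rise
  | weak

/-- The relation between consecutive letters that a constraint imposes. -/
def Step.Rel : Step → ℕ → ℕ → Prop
  | .level, a, b => a = b
  | .rise, a, b => a < b
  | .weak, a, b => a ≤ b

/-- The exchange of equality and strict increase. -/
def Step.swap : Step → Step
  | .level => .rise
  | .rise => .level
  | .weak => .weak

/-- The transfer operator of a constraint, on functions of the difference `i - a_i`. -/
def Step.op : Step → (ℕ → ℕ) → ℕ → ℕ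
  | .level, f, s => f (s + 1)
  | .rise, f, s => ∑ i ∈ Finset.range (s + 1), f i
  | .weak, f, s => ∑ i ∈ Finset.range (s + 2), f i

/-- The composition of the transfer operators of a list of constraints. -/
def run : List Step → (ℕ → ℕ) → ℕ → ℕ
  | [], f => f
  | c :: w, f => c.op (run w f)

theorem run_append (u v : List Step) (f : ℕ → ℕ) : run (u ++ v) f = run u (run v f) := by
  induction u with
  | nil => rfl
  | cons c u ih => rw [List.cons_append, run, run, ih]

theorem Step.op_sum (c : Step) {ι : Type*} (s : Finset ι) (f : ι → ℕ → ℕ) (k : ℕ) :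
    c.op (fun i => ∑ x ∈ s, f x i) k = ∑ x ∈ s, c.op (f x) k := by
  cases c
  · rfl
  · exact Finset.sum_comm
  · exact Finset.sum_comm

theorem run_sum (w : List Step) {ι : Type*} (s : Finset ι) (f : ι → ℕ → ℕ) :
    run w (fun i => ∑ x ∈ s, f x i) = fun k => ∑ x ∈ s, run w (f x) k := by
  induction w with
  | nil => rfl
  | cons c w ih =>
    funext k
    rw [run, ih, Step.op_sum]
    rfl

/-- Transposition for the kernel binom(s+t, t): an operator acting in `s` equals the swapped one
acting in `t`. Equality against strict rise is the hockey-stick identity; for the weak constraint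
both sides are binom(s+t+2, t+1). -/
theorem Step.op_swap_choose (c : Step) (s t : ℕ) :
    c.swap.op (fun i => (i + t).choose t) s = c.op (fun j => (s + j).choose j) t := by
  have hsymm : ∀ a b : ℕ, (a + b).choose a = (a + b).choose b := fun a b => by
    rw [Nat.choose_symm_add]
  cases c
  · change ∑ i ∈ Finset.range (s + 1), (i + t).choose t = (s + (t + 1)).choose (t + 1)
    rw [Nat.sum_range_add_choose]
    rfl
  · change (s + 1 + t).choose t = ∑ j ∈ Finset.range (t + 1), (s + j).choose j
    have := Nat.sum_range_add_choose t s
    rw [← hsymm, show s + 1 + t = t + s + 1 by ring, ← this]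
    refine Finset.sum_congr rfl fun j _ => ?_
    rw [← hsymm, add_comm]
  · change ∑ i ∈ Finset.range (s + 2), (i + t).choose t =
      ∑ j ∈ Finset.range (t + 2), (s + j).choose j
    have h1 := Nat.sum_range_add_choose (s + 1) t
    have h2 := Nat.sum_range_add_choose (t + 1) s
    rw [h1]
    have h3 : ∀ j ∈ Finset.range (t + 2), (s + j).choose j = (j + s).choose s := fun j _ => by
      rw [← hsymm, add_comm]
    rw [Finset.sum_congr rfl h3, h2, show s + 1 + t + 1 = (t + 1) + (s + 1) by ring,
      show t + 1 + s + 1 = (t + 1) + (s + 1) by ring, hsymm]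

/-- The operators are moved across the kernel one at a time, as in the transpose of a product; this
is what reverses their order. -/
theorem run_reverse_swap_choose (w : List Step) (s t : ℕ) :
    run (w.reverse.map Step.swap) (fun i => (i + t).choose t) s =
      run w (fun j => (s + j).choose j) t := by
  induction w generalizing t with
  | nil => rfl
  | cons c w ih =>
    rw [List.reverse_cons, List.map_append, run_append]
    change run _ (c.swap.op fun i => (i + t).choose t) s = c.op (run w _) t
    rw [show (c.swap.op fun i => (i + t).choose t) = fun s => c.op (fun j => (s + j).choose j) t from
      funext fun s => c.op_swap_choose s t]
    cases c
    · exact ih (t + 1)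
    · change run _ (fun s => ∑ j ∈ Finset.range (t + 1), (s + j).choose j) s = _
      rw [run_sum]
      exact Finset.sum_congr rfl fun j _ => ih j
    · change run _ (fun s => ∑ j ∈ Finset.range (t + 2), (s + j).choose j) s = _
      rw [run_sum]
      exact Finset.sum_congr rfl fun j _ => ih j

/-- Mirror images: reversing a list of constraints and exchanging equality and strict increase does
not change the number of nondecreasing parking functions that satisfy them. -/
theorem run_reverse_swap (w : List Step) :
    run (w.reverse.map Step.swap) (fun _ => 1) 0 = run w (fun _ => 1) 0 := by
  -- At `s = t = 0` both kernel functions are constantly 1.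
  simpa using run_reverse_swap_choose w 0 0

/-- The constraints attached to a sequence of blocks: equality within the blocks, and `e` at the
beginning of each block. -/
def blockSteps (e : Step) (L : List ℕ) : List Step :=
  L.flatMap fun j => e :: List.replicate (j - 1) Step.level

theorem blockSteps_cons (e : Step) (j : ℕ) (L : List ℕ) :
    blockSteps e (j :: L) = e :: (List.replicate (j - 1) Step.level ++ blockSteps e L) := by
  simp [blockSteps]

theorem run_replicate_level (j : ℕ) (f : ℕ → ℕ) (s : ℕ) :
    run (List.replicate j Step.level) f s = f (s + j) := by
  induction j generalizing s with
  | zero => rfl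
  | succ j ih =>
    rw [List.replicate_succ, run]
    change run _ f (s + 1) = _
    rw [ih]
    congr 1
    ring

theorem run_blockSteps {e : Step} {m : ℕ}
    (he : ∀ f s, e.op f s = ∑ i ∈ Finset.range (s + 1 + m), f i) {L : List ℕ} (hL : ∀ j ∈ L, 0 < j)
    (s : ℕ) : run (blockSteps e L) (fun _ => 1) s = wt m L (s + 1 + m) := by
  induction L generalizing s with
  | nil => rfl
  | cons j L ih =>
    rw [blockSteps_cons, run, he, wt]
    refine Finset.sum_congr rfl fun i _ => ?_
    have := hL j (by simp)
    rw [run_append, run_replicate_level, ih fun i hi => hL i (by simp [hi])]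
    congr 1
    omega

/-- The head constraint is dropped because the first letter of a parking function is forced. The
value `m` is 0 for a strict rise and 1 for a weak increase. -/
theorem run_tail_blockSteps {e : Step} {m : ℕ}
    (he : ∀ f s, e.op f s = ∑ i ∈ Finset.range (s + 1 + m), f i) {L : List ℕ}
    (hL : ∀ j ∈ L, 0 < j) : run (blockSteps e L).tail (fun _ => 1) 0 = wt m L 1 := by
  cases L with
  | nil => rfl
  | cons j L =>
    have := hL j (by simp)
    rw [blockSteps_cons, List.tail_cons, run_append, run_replicate_level,
      run_blockSteps he fun i hi => hL i (by simp [hi])]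
    simp only [wt, Finset.sum_range_one]
    congr 1
    omega

theorem rise_op (f : ℕ → ℕ) (s : ℕ) : Step.rise.op f s = ∑ i ∈ Finset.range (s + 1 + 0), f i := rfl

theorem weak_op (f : ℕ → ℕ) (s : ℕ) : Step.weak.op f s = ∑ i ∈ Finset.range (s + 1 + 1), f i := rfl

end Runs

/-! ### Counting nondecreasing parking functions under constraints -/

section Count

open scoped Classical in
/-- The sequences of letters `a_{i+1}, a_{i+2}, …` that satisfy a list of constraints, where
`a_i = b` and `a_k ≤ k`. -/
noncomputable def walks : List Step → ℕ → ℕ → Finset (List ℕ)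
  | [], _, _ => {[]}
  | c :: w, i, b => ((Finset.range (i + 2)).filter (c.Rel b)).biUnion fun v =>
      (walks w (i + 1) v).map ⟨List.cons v, List.cons_injective⟩

/-- The change of variable from the next letter `v` to the difference `i + 1 - v` turns the
admissible letters into the summation range of the operator. -/
theorem Step.sum_rel (c : Step) (f : ℕ → ℕ) {i b : ℕ} (hb : b ≤ i) [DecidablePred (c.Rel b)] :
    ∑ v ∈ (Finset.range (i + 2)).filter (c.Rel b), f (i + 1 - v) = c.op f (i - b) := by
  cases c
  · rw [Finset.sum_eq_single b]
    · change _ = f _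
      congr 1
      omega
    · intro v hv hne
      rw [Finset.mem_filter] at hv
      exact absurd hv.2.symm hne
    · intro hn
      rw [Finset.mem_filter, Finset.mem_range] at hn
      exact absurd ⟨by omega, rfl⟩ hn
  · refine Finset.sum_nbij' (fun v => i + 1 - v) (fun s => i + 1 - s) ?_ ?_ ?_ ?_ ?_ <;>
      intro v hv <;> simp only [Finset.mem_filter, Finset.mem_range, Step.Rel] at hv ⊢ <;> omega
  · refine Finset.sum_nbij' (fun v => i + 1 - v) (fun s => i + 1 - s) ?_ ?_ ?_ ?_ ?_ <;>
      intro v hv <;> simp only [Finset.mem_filter, Finset.mem_range, Step.Rel] at hv ⊢ <;> omega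

theorem card_walks (w : List Step) {i b : ℕ} (hb : b ≤ i) :
    (walks w i b).card = run w (fun _ => 1) (i - b) := by
  classical
  induction w generalizing i b with
  | nil => simp [walks, run]
  | cons c w ih =>
    rw [walks, Finset.card_biUnion, run, ← Step.sum_rel c _ hb]
    · refine Finset.sum_congr (by congr) fun v hv => ?_
      have := Finset.mem_range.mp (Finset.mem_filter.mp hv).1
      rw [Finset.card_map, ih (by omega)]
    · intro v _ v' _ hne
      rw [Function.onFun, Finset.disjoint_left]
      rintro l hl hl'
      obtain ⟨x, -, rfl⟩ := Finset.mem_map.mp hl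
      obtain ⟨y, -, hy⟩ := Finset.mem_map.mp hl'
      exact hne (List.cons_eq_cons.mp hy).1.symm

theorem mem_walks {w : List Step} {i b : ℕ} {l : List ℕ} : l ∈ walks w i b ↔
    ∃ h : l.length = w.length, ∀ (k : ℕ) (hk : k < w.length), l[k] ≤ i + 1 + k ∧
      (w[k]).Rel ((b :: l)[k]'(by rw [List.length_cons]; omega)) l[k] := by
  induction w generalizing i b l with
  | nil => simp [walks]
  | cons c w ih =>
    simp only [walks, Finset.mem_biUnion, Finset.mem_filter, Finset.mem_range, Finset.mem_map,
      Function.Embedding.coeFn_mk, ih]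
    constructor
    · rintro ⟨v, ⟨hv, hr⟩, l, ⟨hl, h⟩, rfl⟩
      refine ⟨by simp [hl], fun k hk => ?_⟩
      cases k with
      | zero => exact ⟨by simp; omega, hr⟩
      | succ k =>
        have := h k (by simpa using hk)
        exact ⟨by simp; omega, this.2⟩
    · rintro ⟨hl, h⟩
      cases l with
      | nil => simp at hl
      | cons v l =>
        have h0 := h 0 (by simp)
        refine ⟨v, ⟨by simpa [Nat.lt_succ_iff] using h0.1, h0.2⟩, l, ⟨by simpa using hl, fun k hk => ?_⟩, rfl⟩
        have := h (k + 1) (by simpa using hk)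
        refine ⟨?_, this.2⟩
        have := this.1
        simp at this
        omega

theorem isNDPF_iff {m : ℕ} {a : Fin (m + 1) → Fin (m + 1)} :
    IsNDPF a ↔ (∀ i : Fin m, (a i.castSucc : ℕ) ≤ a i.succ) ∧ ∀ i, (a i : ℕ) ≤ i := by
  rw [IsNDPF, Fin.monotone_iff_le_succ]
  rfl

/-- The number of nondecreasing parking functions that satisfy a list of constraints. -/
theorem card_isNDPF {m : ℕ} (w : Fin m → Step) :
    Nat.card {a : Fin (m + 1) → Fin (m + 1) //
      IsNDPF a ∧ ∀ i, (w i).Rel (a i.castSucc) (a i.succ)} =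
      run (List.ofFn w) (fun _ => 1) 0 := by
  have hrel : ∀ c : Step, ∀ x y, c.Rel x y → x ≤ y := by
    intro c x y h
    cases c
    · exact Nat.le_of_eq h
    · exact Nat.le_of_lt h
    · exact h
  rw [← card_walks (i := 0) (b := 0) (List.ofFn w) le_rfl, ← Nat.card_eq_finsetCard]
  -- The map forgets the first letter, which is 0 in every parking function.
  refine Nat.card_eq_of_bijective (fun a => ⟨List.ofFn fun i : Fin m => (a.1 i.succ : ℕ), ?_⟩) ⟨?_, ?_⟩
  · obtain ⟨a, ha, hr⟩ := a
    rw [isNDPF_iff] at ha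
    rw [mem_walks]
    refine ⟨by simp, fun k hk => ?_⟩
    rw [List.length_ofFn] at hk
    refine ⟨?_, ?_⟩
    · have := ha.2 (Fin.succ ⟨k, hk⟩)
      simp only [List.getElem_ofFn, Fin.val_succ] at this ⊢
      omega
    · have := hr ⟨k, hk⟩
      cases k with
      | zero =>
        rw [show (a (Fin.castSucc ⟨0, hk⟩) : ℕ) = 0 from Nat.le_zero.mp (ha.2 _)] at this
        simp only [List.getElem_ofFn, List.getElem_cons_zero]
        exact this
      | succ k =>
        simp only [List.getElem_ofFn, List.getElem_cons_succ]
        exact this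
  · rintro ⟨a, ha, _⟩ ⟨a', ha', _⟩ h
    have h := List.ofFn_injective (congrArg Subtype.val h)
    rw [isNDPF_iff] at ha ha'
    refine Subtype.ext (funext fun i => Fin.ext ?_)
    cases i using Fin.cases with
    | zero => rw [Nat.le_zero.mp (ha.2 0), Nat.le_zero.mp (ha'.2 0)]
    | succ i => exact congrFun h i
  · rintro ⟨l, hl⟩
    rw [mem_walks] at hl
    obtain ⟨hl, h⟩ := hl
    rw [List.length_ofFn] at hl
    have hlt : ∀ k : Fin m, l[k] ≤ 1 + k := fun k => by
      have := (h k (by simp)).1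
      rw [zero_add] at this
      exact this
    have hbound : ∀ k : Fin (m + 1), (0 :: l)[(k : ℕ)]'(by rw [List.length_cons]; omega) ≤ k := by
      intro k
      cases k using Fin.cases with
      | zero => simp
      | succ k =>
        have := hlt k
        simp only [Fin.val_succ, List.getElem_cons_succ, Fin.getElem_fin] at this ⊢
        omega
    have hr : ∀ k : Fin m, (w k).Rel ((0 :: l)[(k : ℕ)]'(by rw [List.length_cons]; omega)) l[k] := by
      intro k
      have := (h k (by simp)).2
      rw [List.getElem_ofFn] at this
      exact this
    refine ⟨⟨fun k => ⟨(0 :: l)[(k : ℕ)]'(by rw [List.length_cons]; omega),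
      lt_of_le_of_lt (hbound k) k.2⟩, isNDPF_iff.mpr ⟨fun k => hrel _ _ _ (hr k), hbound⟩, hr⟩, ?_⟩
    refine Subtype.ext (List.ext_getElem (by simp [hl]) fun k h1 h2 => ?_)
    rw [List.getElem_ofFn]
    rfl

theorem eq_of_replicate_append_eq {α : Type*} {x : α} {p q : ℕ} {u v : List α}
    (hu : u.head? ≠ some x) (hv : v.head? ≠ some x)
    (h : List.replicate p x ++ u = List.replicate q x ++ v) : p = q ∧ u = v := by
  induction p generalizing q with
  | zero =>
    cases q with
    | zero => simpa using h
    | succ q =>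
      rw [List.replicate_zero, List.nil_append] at h
      simp [h, List.replicate_succ] at hu
  | succ p ih =>
    cases q with
    | zero =>
      rw [List.replicate_zero, List.nil_append] at h
      simp [← h, List.replicate_succ] at hv
    | succ q =>
      have := ih (q := q) (by simpa [List.replicate_succ] using h)
      exact ⟨by rw [this.1], this.2⟩

theorem head_blockSteps_rise (L : List ℕ) : (blockSteps .rise L).head? ≠ some .level := by
  cases L with
  | nil => simp [blockSteps]
  | cons j L => simp [blockSteps_cons]

/-- Each rise marks the start of a block, so the block lengths can be read back. Positivity is
needed because the truncated `j - 1` does not distinguish lengths 0 and 1. -/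
theorem blockSteps_rise_injective {L L' : List ℕ} (hL : ∀ j ∈ L, 0 < j) (hL' : ∀ j ∈ L', 0 < j)
    (h : blockSteps .rise L = blockSteps .rise L') : L = L' := by
  induction L generalizing L' with
  | nil =>
    cases L' with
    | nil => rfl
    | cons j L' => simp [blockSteps] at h
  | cons i L ih =>
    cases L' with
    | nil => simp [blockSteps] at h
    | cons j L' =>
      rw [blockSteps_cons, blockSteps_cons] at h
      obtain ⟨h1, h2⟩ := eq_of_replicate_append_eq (head_blockSteps_rise _) (head_blockSteps_rise _)
        (List.cons_eq_cons.mp h).2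
      have hi := hL i (by simp)
      have hj := hL' j (by simp)
      rw [ih (fun i hi => hL i (by simp [hi])) (fun i hi => hL' i (by simp [hi])) h2,
        show i = j by omega]

/-- The nonzero multiplicities of the letters of a word. -/
def mults (N : ℕ) (l : List ℕ) : List ℕ := ((List.range N).map (l.count ·)).filter (· ≠ 0)

theorem mults_eq {N b : ℕ} (hb : b < N) {l : List ℕ} (hl : ∀ v ∈ l, b ≤ v) :
    mults N l = [l.count b].filter (· ≠ 0) ++
      ((List.range' (b + 1) (N - b - 1)).map (l.count ·)).filter (· ≠ 0) := by
  have hN : List.range N = List.range b ++ ([b] ++ List.range' (b + 1) (N - b - 1)) := by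
    rw [List.singleton_append, ← List.range'_succ, List.range_eq_range', List.range_eq_range']
    have := List.range'_append (s := 0) (m := b) (n := N - b - 1 + 1) (step := 1)
    rw [zero_add, one_mul] at this
    rw [this]
    congr 1
    omega
  rw [mults, hN, List.map_append, List.map_append, List.filter_append, List.filter_append]
  have h0 : ((List.range b).map (l.count ·)).filter (· ≠ 0) = [] := by
    rw [List.filter_eq_nil_iff]
    intro x hx
    obtain ⟨v, hv, rfl⟩ := List.mem_map.mp hx
    have hv := List.mem_range.mp hv
    have : l.count v = 0 := List.count_eq_zero.mpr fun h => absurd (hl v h) (by omega)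
    simp [this]
  rw [h0, List.nil_append]
  rfl

theorem mults_cons {N b : ℕ} (hb : b < N) {l : List ℕ} (hl : ∀ v ∈ l, b ≤ v) :
    mults N (b :: l) = (l.count b + 1) ::
      ((List.range' (b + 1) (N - b - 1)).map (l.count ·)).filter (· ≠ 0) := by
  rw [mults_eq hb (by simpa using hl), List.count_cons_self]
  have : (List.range' (b + 1) (N - b - 1)).map ((b :: l).count ·) =
      (List.range' (b + 1) (N - b - 1)).map (l.count ·) := by
    refine List.map_congr_left fun v hv => ?_
    have := (List.mem_range'_1.mp hv).1
    rw [List.count_cons_of_ne (by omega)]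
  rw [this]
  simp

/-- The pattern of equalities and strict increases of the word `b :: l`. -/
def pattern : ℕ → List ℕ → List Step
  | _, [] => []
  | b, v :: l => (if b < v then .rise else .level) :: pattern v l

/-- In a sorted word equal letters are adjacent, so the multiplicities are the lengths of the
maximal constant runs. Prepending a letter either opens a new run or lengthens the first one. -/
theorem blockSteps_mults {N b : ℕ} {l : List ℕ} (hs : (b :: l).Pairwise (· ≤ ·))
    (hN : ∀ v ∈ b :: l, v < N) : blockSteps .rise (mults N (b :: l)) = .rise :: pattern b l := by
  induction l generalizing b with
  | nil =>
    rw [mults_cons (hN b (by simp)) (by simp)]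
    simp [blockSteps, pattern]
  | cons v l ih =>
    have hb : b < N := hN b (by simp)
    have hle : ∀ x ∈ v :: l, b ≤ x := (List.pairwise_cons.mp hs).1
    have ih := ih (List.pairwise_cons.mp hs).2 fun x hx => hN x (by simp [hx])
    have hbv : b ≤ v := hle v (by simp)
    rw [mults_cons hb hle, pattern]
    rw [mults_eq hb hle] at ih
    rcases hbv.lt_or_eq with h | rfl
    · have h0 : (v :: l).count b = 0 := List.count_eq_zero.mpr fun hm => by
        rcases List.mem_cons.mp hm with rfl | hm
        · omega
        · have := (List.pairwise_cons.mp (List.pairwise_cons.mp hs).2).1 b hm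
          omega
      rw [h0] at ih ⊢
      simp only [ne_eq, not_true_eq_false, decide_false, Bool.false_eq_true, not_false_eq_true,
        List.filter_cons_of_neg, List.filter_nil, List.nil_append] at ih
      rw [blockSteps_cons, if_pos h]
      simpa using ih
    · rw [List.count_cons_self] at ih ⊢
      rw [List.filter_cons_of_pos (by simp), List.filter_nil, List.singleton_append,
        blockSteps_cons, List.cons_inj_right] at ih
      rw [blockSteps_cons, if_neg (lt_irrefl _), ← ih]
      simp [List.replicate_succ]

theorem pattern_ofFn {m : ℕ} (a : Fin (m + 1) → ℕ) :
    pattern (a 0) (List.ofFn fun i : Fin m => a i.succ) =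
      List.ofFn fun i : Fin m => if a i.castSucc < a i.succ then .rise else .level := by
  induction m with
  | zero => simp [pattern]
  | succ m ih =>
    rw [List.ofFn_succ, pattern, ih fun i => a i.succ, List.ofFn_succ]
    rfl

theorem wordType_eq_mults {n : ℕ} (a : Fin n → Fin n) :
    wordType a = mults n (List.ofFn fun i => (a i : ℕ)) := by
  rw [wordType, mults]
  congr 1
  apply List.ext_getElem
  · simp
  · intro v h1 h2
    rw [List.getElem_ofFn, List.getElem_map, List.getElem_range, List.count, List.ofFn_eq_map,
      List.countP_map, List.countP_eq_length_filter]
    change ((List.finRange n).filter _).length = _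
    congr 2
    funext i
    simp [Fin.ext_iff]
    rfl

open scoped Classical in
-- A block starts exactly at a partial sum of the list; this links constraint lists with the
-- boundaries of a composition.
theorem blockSteps_eq_map_range (e : Step) {L : List ℕ} (hL : ∀ j ∈ L, 0 < j) : blockSteps e L = (List.range L.sum).map fun d =>
      if ∃ k, (L.take k).sum = d then e else .level := by
  induction L with
  | nil => simp [blockSteps]
  | cons j L ih =>
    have hj := hL j (by simp)
    rw [blockSteps_cons, ih fun i hi => hL i (by simp [hi]), List.sum_cons, List.range_add,
      List.map_append, ← List.cons_append]
    congr 1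
    · obtain ⟨i, rfl⟩ : ∃ i, j = i + 1 := ⟨j - 1, by omega⟩
      rw [List.range_succ_eq_map, List.map_cons, if_pos ⟨0, rfl⟩, List.map_map, Nat.add_sub_cancel]
      congr 1
      symm
      rw [List.eq_replicate_iff]
      refine ⟨by simp, fun b hb => ?_⟩
      obtain ⟨d, hd, rfl⟩ := List.mem_map.mp hb
      have hd := List.mem_range.mp hd
      refine if_neg ?_
      rintro ⟨k, hk⟩
      cases k with
      | zero => simp at hk
      | succ k =>
        rw [List.take_succ_cons, List.sum_cons] at hk
        omega
    · rw [List.map_map]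
      refine List.map_congr_left fun d _ => ?_
      have : (∃ k, ((j :: L).take k).sum = j + d) ↔ ∃ k, (L.take k).sum = d := by
        constructor
        · rintro ⟨k, hk⟩
          cases k with
          | zero =>
            rw [List.take_zero, List.sum_nil] at hk
            omega
          | succ k =>
            rw [List.take_succ_cons, List.sum_cons] at hk
            exact ⟨k, by omega⟩
        · rintro ⟨k, hk⟩
          exact ⟨k + 1, by rw [List.take_succ_cons, List.sum_cons, hk]⟩
      simp only [Function.comp_apply, this]

theorem exists_sum_take_iff {n : ℕ} (I : Composition n) (d : Fin (n + 1)) :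
    (∃ k, (I.blocks.take k).sum = d) ↔ d ∈ I.boundaries := by
  rw [Composition.boundaries, Finset.mem_map]
  constructor
  · rintro ⟨k, hk⟩
    rcases Nat.lt_or_ge k (I.length + 1) with h | h
    · exact ⟨⟨k, h⟩, Finset.mem_univ _, Fin.ext hk⟩
    · refine ⟨Fin.last _, Finset.mem_univ _, Fin.ext ?_⟩
      rw [← hk, List.take_of_length_le (by rw [Composition.blocks_length]; omega)]
      change (I.blocks.take I.blocks.length).sum = _
      rw [List.take_length]
  · rintro ⟨i, -, rfl⟩
    exact ⟨i, rfl⟩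

theorem length_blockSteps (e : Step) {L : List ℕ} (hL : ∀ j ∈ L, 0 < j) :
    (blockSteps e L).length = L.sum := by
  classical
  simp [blockSteps_eq_map_range e hL]

theorem getElem_blockSteps {n : ℕ} (e : Step) (I : Composition n) (d : ℕ) (hd : d < n + 1)
    (h : d < (blockSteps e I.blocks).length) [Decidable (⟨d, hd⟩ ∈ I.boundaries)] :
    (blockSteps e I.blocks)[d] = if ⟨d, hd⟩ ∈ I.boundaries then e else .level := by
  classical
  simp [blockSteps_eq_map_range e fun _ => I.blocks_pos, ← exists_sum_take_iff]

/-- The number of nondecreasing parking functions of a given type. -/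
theorem numNDPF_eq {n : ℕ} (J : Composition n) : numNDPF J = wt 0 J.blocks 1 := by
  have hpos : ∀ j ∈ J.blocks, 0 < j := fun _ => J.blocks_pos
  rw [← run_tail_blockSteps rise_op hpos]
  cases n with
  | zero =>
    have hJ : J.blocks = [] := by
      rw [← List.length_eq_zero_iff]
      simp
    rw [hJ, numNDPF]
    have : Unique {a : Fin 0 → Fin 0 // IsNDPF a ∧ wordType a = J.blocks} :=
      { default := ⟨Fin.elim0, ⟨fun i => i.elim0, fun i => i.elim0⟩, by simp [wordType, hJ]⟩
        uniq := fun a => Subsingleton.elim _ _ }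
    simp [blockSteps, run]
  | succ m =>
    have hlen : (blockSteps .rise J.blocks).length = m + 1 := by
      rw [length_blockSteps _ hpos, J.blocks_sum]
    obtain ⟨w, hw⟩ : ∃ w : Fin m → Step, (blockSteps .rise J.blocks).tail = List.ofFn w := by
      refine ⟨fun i => (blockSteps .rise J.blocks).tail[(i : ℕ)]'(by rw [List.length_tail]; omega), ?_⟩
      apply List.ext_getElem
      · simp [hlen]
      · intro i h1 h2
        simp
    have hcons : blockSteps .rise J.blocks = .rise :: List.ofFn w := by
      rw [← hw]
      cases h : J.blocks with
      | nil => simp [h, blockSteps] at hlen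
      | cons j L => rw [blockSteps_cons, List.tail_cons]
    have hwl : ∀ i, w i ≠ .weak := by
      intro i hi
      have hmem : Step.weak ∈ blockSteps .rise J.blocks := by
        rw [hcons, ← hi]
        simp
      simp [blockSteps] at hmem
    rw [hw, ← card_isNDPF, numNDPF]
    refine Nat.card_congr (Equiv.subtypeEquivRight fun a => and_congr_right fun ha => ?_)
    have ha' := isNDPF_iff.mp ha
    have hl : (List.ofFn fun i => (a i : ℕ)) =
        (a 0 : ℕ) :: List.ofFn fun i : Fin m => (a i.succ : ℕ) :=
      List.ofFn_succ
    have hsorted : (List.ofFn fun i => (a i : ℕ)).Pairwise (· ≤ ·) := by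
      rw [List.pairwise_ofFn]
      exact fun i j hij => ha.1 hij.le
    have hmults := blockSteps_mults (N := m + 1) (hl ▸ hsorted) (by
      rw [← hl]
      intro v hv
      obtain ⟨i, rfl⟩ := List.mem_ofFn.mp hv
      exact (a i).2)
    rw [← hl, ← wordType_eq_mults, pattern_ofFn fun i => (a i : ℕ)] at hmults
    have hposW : ∀ j ∈ wordType a, 0 < j := by
      intro j hj
      have := (List.mem_filter.mp hj).2
      exact Nat.pos_of_ne_zero (by simpa using this)
    -- The type and the pattern of rises and equalities determine each other.
    have h1 : wordType a = J.blocks ↔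
        ∀ i : Fin m, (if (a i.castSucc : ℕ) < a i.succ then Step.rise else .level) = w i := by
      rw [← funext_iff, ← List.ofFn_injective.eq_iff, ← List.cons_inj_right Step.rise, ← hcons,
        ← hmults]
      exact ⟨fun h => by rw [h], blockSteps_rise_injective hposW hpos⟩
    rw [h1]
    refine forall_congr' fun i => ?_
    have hle := ha'.1 i
    have := hwl i
    rcases hwi : w i with _ | _ | _
    · change _ ↔ (a i.castSucc : ℕ) = a i.succ
      split_ifs <;> simp <;> omega
    · change _ ↔ (a i.castSucc : ℕ) < a i.succ
      split_ifs <;> simp <;> omega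
    · exact absurd hwi this

theorem mem_boundaries_conj {n : ℕ} (I : Composition n) (j : Fin (n + 1)) :
    j ∈ (conj I).boundaries ↔ j = 0 ∨ j = Fin.last n ∨ j.rev ∉ I.boundaries := by
  rw [conj, CompositionAsSet.toComposition_boundaries]
  simp

/-- The number of parking quasi-ribbons whose shape is the conjugate of a composition. -/
theorem card_quasiRibbon_conj {n : ℕ} (K : Composition n) :
    Nat.card {a : Fin n → Fin n // IsParkingQuasiRibbon (conj K) a} = wt 1 K.blocks 1 := by
  classical
  have hpos : ∀ j ∈ K.blocks, 0 < j := fun _ => K.blocks_pos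
  rw [← run_tail_blockSteps weak_op hpos]
  cases n with
  | zero =>
    have hK : K.blocks = [] := by
      rw [← List.length_eq_zero_iff]
      simp
    rw [hK]
    have : Unique {a : Fin 0 → Fin 0 // IsParkingQuasiRibbon (conj K) a} :=
      { default := ⟨Fin.elim0, ⟨fun i => i.elim0, fun i => i.elim0⟩, fun i => i.elim0⟩
        uniq := fun a => Subsingleton.elim _ _ }
    simp [blockSteps, run]
  | succ m =>
    have hlen : (blockSteps .weak K.blocks).length = m + 1 := by
      rw [length_blockSteps _ hpos, K.blocks_sum]
    let w : Fin m → Step := fun i =>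
      if i.succ.castSucc ∈ (conj K).boundaries then .rise else .weak
    -- The block list of `K` is weak at interior boundaries and level elsewhere. After reversal and
    -- swap, the strict rises sit at the mirror images of the non-boundaries, that is, at the
    -- descents of the conjugate.
    have hw : (blockSteps .weak K.blocks).tail.reverse.map Step.swap = List.ofFn w := by
      apply List.ext_getElem
      · simp [hlen]
      · intro i h1 h2
        have hi : i < m := by simpa using h2
        rw [List.getElem_map, List.getElem_reverse, List.getElem_tail, List.getElem_ofFn,
          getElem_blockSteps _ _ _ (by rw [List.length_tail]; omega)]
        have h3 : (⟨i, hi⟩ : Fin m).succ.castSucc ∈ (conj K).boundaries ↔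
            (⟨i, hi⟩ : Fin m).succ.castSucc.rev ∉ K.boundaries := by
          rw [mem_boundaries_conj, Fin.ext_iff, Fin.ext_iff]
          simp only [Fin.val_castSucc, Fin.val_succ, Fin.val_zero, Fin.val_last]
          constructor
          · rintro (h | h | h)
            · omega
            · omega
            · exact h
          · exact fun h => Or.inr (Or.inr h)
        have h4 : (⟨i, hi⟩ : Fin m).succ.castSucc.rev =
            ⟨(blockSteps .weak K.blocks).tail.length - 1 - i + 1, by
              rw [List.length_tail]; omega⟩ := by
          apply Fin.ext
          have : (blockSteps .weak K.blocks).tail.length = m := by rw [List.length_tail, hlen]; rfl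
          change m + 1 + 1 - (i + 1 + 1) = (blockSteps .weak K.blocks).tail.length - 1 - i + 1
          rw [this]
          omega
        simp only [w, h3, h4]
        split_ifs <;> simp_all [Step.swap]
    rw [← run_reverse_swap, hw, ← card_isNDPF]
    refine Nat.card_congr (Equiv.subtypeEquivRight fun a => and_congr_right fun ha => ?_)
    have ha' := isNDPF_iff.mp ha
    constructor
    · intro h i
      simp only [w]
      split_ifs with hi
      · exact h i.castSucc i.succ (by simp) hi
      · exact ha'.1 i
    · intro h i j hij hj
      obtain ⟨k, rfl⟩ := Fin.exists_succ_eq_of_ne_zero (x := j) fun h => by simp [h] at hij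
      obtain rfl : i = k.castSucc := by
        apply Fin.ext
        simp only [Fin.val_succ, Fin.val_castSucc] at hij ⊢
        omega
      have := h k
      simp only [w, if_pos hj] at this
      exact this

end Count

/-! ### Products of the g_n and assembly of the antipode formulas -/

section Expansions

variable {R : Type*} [CommRing R]

theorem ofFn_sum_prod {A : Type*} [Semiring A] {r : ℕ} {τ : Fin r → Type*} [∀ k, Fintype (τ k)]
    (f : ∀ k, τ k → A) : (List.ofFn fun k => ∑ t, f k t).prod =
      ∑ t : ∀ k, τ k, (List.ofFn fun k => f k (t k)).prod := by
  induction r with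
  | zero => simp
  | succ r ih =>
    rw [List.ofFn_succ, List.prod_cons, ih, Finset.sum_mul_sum, ← Fintype.sum_prod_type',
      ← (Fin.consEquiv τ).sum_comp]
    refine Finset.sum_congr rfl fun t _ => ?_
    rw [List.ofFn_succ, List.prod_cons]
    rfl

theorem ofFn_smul_prod {A : Type*} [Ring A] [Algebra R A] {r : ℕ} (a : Fin r → R) (x : Fin r → A) :
    (List.ofFn fun k => a k • x k).prod = (∏ k, a k) • (List.ofFn x).prod := by
  induction r with
  | zero => simp
  | succ r ih =>
    rw [List.ofFn_succ, List.prod_cons, ih, List.ofFn_succ, List.prod_cons, Fin.prod_univ_succ,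
      smul_mul_smul_comm]

theorem SProd_flatten {r : ℕ} (L : Fin r → List ℕ) :
    SProd R (List.ofFn L).flatten = (List.ofFn fun k => SProd R (L k)).prod := by
  rw [SProd, List.map_flatten, List.prod_flatten, List.map_ofFn, List.map_ofFn]
  rfl

theorem repr_SProd {n : ℕ} (K I : Composition n) [Decidable (K.blocks = I.blocks)] :
    (SBasis R).repr (SProd R K.blocks) (word I) = if K.blocks = I.blocks then 1 else 0 := by
  have h : K.blocks = I.blocks ↔ K = I := ⟨Composition.ext, fun h => h ▸ rfl⟩
  classical
  rw [show SProd R K.blocks = SBasis R (word K) by rw [SBasis_apply, parts_word],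
    Module.Basis.repr_self, Finsupp.single_apply]
  simp only [word_injective.eq_iff, h]

/-- Each multiplicity is spread over the quasi-ribbons it counts, so that a product of such sums
expands into a sum over the sequences counted by `numQuasiRibbons`. -/
theorem lamHom_g_eq_sum_quasiRibbon (n : ℕ)
    [inst : Fintype (Σ K : Composition n, {a : Fin n → Fin n // IsParkingQuasiRibbon (conj K) a})] :
    lamHom R (g R n) =
      ∑ t : Σ K : Composition n, {a : Fin n → Fin n // IsParkingQuasiRibbon (conj K) a},
        (-1 : R) ^ (n - t.1.length) • SProd R t.1.blocks := by
  classical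
  rw [lamHom_g_eq_sum]
  have : ∀ K : Composition n,
      Fintype {a : Fin n → Fin n // IsParkingQuasiRibbon (conj K) a} := fun _ => Fintype.ofFinite _
  rw [Subsingleton.elim inst Sigma.instFintype, Fintype.sum_sigma]
  refine Finset.sum_congr rfl fun K _ => ?_
  dsimp only
  rw [Finset.sum_const, Finset.card_univ, ← Nat.card_eq_fintype_card, card_quasiRibbon_conj,
    mul_comm, mul_smul, Nat.cast_smul_eq_nsmul]

/-- The coefficient of `Λ^I` in `g^J`. -/
theorem repr_lamHom_gProd {n : ℕ} (I J : Composition n) :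
    (SBasis R).repr (lamHom R (gProd R J)) (word I) =
      (-1) ^ (n - I.length) * (numQuasiRibbons I J : R) := by
  classical
  have hfin : ∀ m : ℕ, Fintype
      (Σ K : Composition m, {a : Fin m → Fin m // IsParkingQuasiRibbon (conj K) a}) :=
    fun _ => Fintype.ofFinite _
  have h1 : lamHom R (gProd R J) = (List.ofFn fun k => lamHom R (g R (J.blocksFun k))).prod := by
    rw [gProd, map_list_prod, List.map_map, ← J.ofFn_blocksFun, List.map_ofFn]
    rfl
  rw [h1]
  simp only [lamHom_g_eq_sum_quasiRibbon]
  rw [ofFn_sum_prod, map_sum, Finsupp.finsetSum_apply]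
  have hT : ∀ T : (k : Fin J.length) → Σ K : Composition (J.blocksFun k),
      {a : Fin (J.blocksFun k) → Fin (J.blocksFun k) // IsParkingQuasiRibbon (conj K) a},
      (SBasis R).repr (List.ofFn fun k => (-1 : R) ^ (J.blocksFun k - (T k).1.length) •
        SProd R (T k).1.blocks).prod (word I) =
      if (List.ofFn fun k => (T k).1.blocks).flatten = I.blocks then (-1) ^ (n - I.length) else 0 := by
    intro T
    let K : Composition n := ⟨(List.ofFn fun k => (T k).1.blocks).flatten, by
      intro i hi
      obtain ⟨l, hl, hi⟩ := List.mem_flatten.mp hi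
      obtain ⟨k, rfl⟩ := List.mem_ofFn.mp hl
      exact (T k).1.blocks_pos hi, by
      rw [List.sum_flatten, List.map_ofFn, List.sum_ofFn]
      simp only [Function.comp_apply, Composition.blocks_sum]
      exact J.sum_blocksFun⟩
    have hlen : ∑ k, (T k).1.length = K.length := by
      change _ = (List.ofFn fun k => (T k).1.blocks).flatten.length
      rw [List.length_flatten, List.map_ofFn, List.sum_ofFn]
      rfl
    -- The signs multiply to one depending only on the concatenation, hence there is no
    -- cancellation.
    have hsign : ∑ k, (J.blocksFun k - (T k).1.length) = n - K.length := by
      have := Finset.sum_congr (rfl : (Finset.univ : Finset (Fin J.length)) = _) fun k _ =>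
        Nat.sub_add_cancel (T k).1.length_le
      rw [Finset.sum_add_distrib, hlen, J.sum_blocksFun] at this
      omega
    rw [ofFn_smul_prod, Finset.prod_pow_eq_pow_sum, hsign, ← SProd_flatten, map_smul,
      Finsupp.smul_apply]
    change _ • (SBasis R).repr (SProd R K.blocks) (word I) = if K.blocks = I.blocks then _ else _
    rw [repr_SProd]
    split_ifs with h
    · rw [show K = I from Composition.ext h, smul_eq_mul, mul_one]
    · rw [smul_zero]
  rw [Finset.sum_congr rfl fun T _ => hT T, ← Finset.sum_filter, Finset.sum_const, nsmul_eq_mul,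
    mul_comm, numQuasiRibbons, Nat.card_eq_fintype_card, Fintype.card_subtype]

theorem gHom_SProd {n : ℕ} (I : Composition n) : gHom R (SProd R I.blocks) = gProd R I := by
  rw [SProd, map_list_prod, List.map_map, gProd]
  congr 1
  exact List.map_congr_left fun k _ => gHom_S R k

theorem homog_gProd {n : ℕ} (I : Composition n) : gProd R I ∈ homog R n := by
  have := homog_SProd (gHom R) (fun n => by rw [gHom_S]; exact homog_g n) I.blocks
  rwa [I.blocks_sum, gHom_SProd] at this

theorem anti_SProd (L : List ℕ) :
    anti R (SProd R L) = (-1) ^ L.sum * (L.reverse.map (Lam R)).prod := by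
  induction L with
  | nil => simp [SProd, anti_one]
  | cons k L ih =>
    have h : SProd R (k :: L) = S R k * SProd R L := by simp [SProd]
    rw [h, anti_mul, anti_S, ih, Sneg, ← neg_one_pow_mul_mul, List.sum_cons, add_comm,
      List.reverse_cons, List.map_append, List.prod_append]
    simp

theorem parts_reverse (w : FreeMonoid ℕ+) : parts w.reverse = (parts w).reverse := by
  exact List.map_reverse

theorem chi_gProd {n : ℕ} (I : Composition n) : chi R (gProd R I) = gProd R I.reverse := by
  rw [← gBasis_word, chi, Module.Basis.constr_basis, gBasis_apply, parts_reverse, parts_word, gProd]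
  rfl

/-- On S^K the antipode reverses the product and gives (-1)^n Λ^{K̄}; by `tilde_g` this is the tilde
of g^{K̄} = χ(g^K), up to the same sign. -/
theorem anti_eq_of_homog {n : ℕ} {x : NSym R} (hx : x ∈ homog R n) :
    anti R x = (-1) ^ n * tilde R (chi R (gHom R x)) := by
  rw [eq_sum_of_homog hx]
  simp only [map_sum, map_smul, Finset.mul_sum, mul_smul_comm]
  refine Finset.sum_congr rfl fun K _ => ?_
  rw [anti_SProd, K.blocks_sum, gHom_SProd, chi_gProd, gProd, map_list_prod, List.map_map]
  congr 3
  exact List.map_congr_left fun k _ => (tilde_g R k).symm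

theorem antipode_g (n : ℕ) :
    HopfAlgebra.antipode R (g R n) = (-1) ^ n * tilde R (chi R (g2 R n)) := by
  rw [← gHom_g]
  exact anti_eq_of_homog (homog_g n)

theorem chi_g2 (n : ℕ) : chi R (g2 R n) =
    ∑ J : Composition n, pairing (M R J.reverse) (g R n) • gProd R J := by
  conv_lhs => rw [← gHom_g, eq_sum_of_homog (homog_g n)]
  simp only [map_sum, map_smul, gHom_SProd, chi_gProd]
  refine Fintype.sum_bijective _ Composition.reverse_bijective _ _ fun K => ?_
  rw [Composition.reverse_reverse, pairing_M]

theorem pairing_V_gProd {n : ℕ} (I J : Composition n) :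
    pairing (V R I) (gProd R J) = (-1) ^ (n - I.length) * (numQuasiRibbons I J : R) := by
  rw [pairing_V]
  exact repr_lamHom_gProd I J

theorem pairing_M_g {n : ℕ} (J : Composition n) : pairing (M R J) (g R n) = (numNDPF J : R) := by
  rw [pairing_M, repr_g, if_pos (sum_parts_word J), parts_word, numNDPF_eq]

theorem repr_neg_one_pow_mul {ι : Type*} (b : Module.Basis ι R (NSym R)) (k : ℕ) (x : NSym R)
    (i : ι) : b.repr ((-1) ^ k * x) i = (-1) ^ k * b.repr x i := by
  have : (-1) ^ k * x = (-1 : R) ^ k • x := by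
    rw [Algebra.smul_def, map_pow, map_neg, map_one]
  rw [this, map_smul, Finsupp.smul_apply, smul_eq_mul]

theorem gHom_lamHom (x : NSym R) : gHom R (lamHom R x) = tilde R x := rfl

/-- The tilde automorphism carries the basis Λ^I to the basis g^I, so coordinates are preserved;
this turns pairing with c_I into pairing with V_I. -/
theorem repr_tilde (x : NSym R) (w : FreeMonoid ℕ+) :
    (gBasis R).repr (tilde R x) w = (LamBasis R).repr x w := by
  have : (gEquiv R).symm (tilde R x) = (lamEquiv R).symm x := by
    rw [tilde, AlgEquiv.trans_apply, AlgEquiv.symm_apply_apply]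
  exact congrArg (fun y => (SBasis R).repr y w) this

theorem pairing_c_antipode_g {n : ℕ} (I : Composition n) :
    pairing (c R I) (HopfAlgebra.antipode R (g R n)) =
      (-1) ^ n * ∑ J : Composition n,
        pairing (V R I) (gProd R J) * pairing (M R J.reverse) (g R n) := by
  rw [antipode_g, pairing_c, repr_neg_one_pow_mul, repr_tilde, ← pairing_V, chi_g2, map_sum]
  simp only [map_smul, smul_eq_mul, mul_comm]

theorem tilde_eq_sum_of_homog {n : ℕ} {x : NSym R} (hx : x ∈ homog R n) :
    tilde R x = ∑ I : Composition n, pairing (V R I) x • gProd R I := by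
  rw [← gHom_lamHom, eq_sum_of_homog (map_mem_homog (lamHom R)
    (fun n => by rw [lamHom_S]; exact homog_Lam n) hx), map_sum]
  refine Finset.sum_congr rfl fun I _ => ?_
  rw [map_smul, gHom_SProd, pairing_V]
  rfl

theorem antipode_g_eq_sum (n : ℕ) : HopfAlgebra.antipode R (g R n) =
    ∑ I : Composition n, ((-1) ^ I.length *
      ((∑ J : Composition n, numQuasiRibbons I J * numNDPF J.reverse : ℕ) : R)) • gProd R I := by
  have hx : chi R (g2 R n) ∈ homog R n := by
    rw [chi_g2]
    exact Submodule.sum_mem _ fun J _ => Submodule.smul_mem _ _ (homog_gProd J)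
  rw [antipode_g, tilde_eq_sum_of_homog hx, Finset.mul_sum]
  refine Finset.sum_congr rfl fun I _ => ?_
  have hV : pairing (V R I) (chi R (g2 R n)) = (-1) ^ (n - I.length) *
      ((∑ J : Composition n, numQuasiRibbons I J * numNDPF J.reverse : ℕ) : R) := by
    rw [chi_g2, map_sum, Nat.cast_sum, Finset.mul_sum]
    refine Finset.sum_congr rfl fun J _ => ?_
    rw [map_smul, pairing_V_gProd, pairing_M_g, Nat.cast_mul, smul_eq_mul]
    ring
  -- The exponents n + (n - ℓ(I)) and ℓ(I) have the same parity.
  have hsign : (-1 : R) ^ n * (-1) ^ (n - I.length) = (-1) ^ I.length := by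
    have hle := I.length_le
    rw [← pow_add, show n + (n - I.length) = 2 * (n - I.length) + I.length by omega, pow_add, pow_mul]
    simp
  have h1 : (-1 : NSym R) ^ n = algebraMap R (NSym R) ((-1) ^ n) := by
    rw [map_pow, map_neg, map_one]
  rw [hV, h1, ← Algebra.smul_def, smul_smul, ← mul_assoc, hsign]

end Expansions

end LagrangeSym

open LagrangeSym
theorem mainTheorem6 (R : Type*) [CommRing R] (n : ℕ) :
    HopfAlgebra.antipode R (g R n) = (-1) ^ n * tilde R (chi R (g2 R n)) ∧
    (∀ I : Composition n,
      pairing (c R I) (HopfAlgebra.antipode R (g R n)) =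
        (-1) ^ n * ∑ J : Composition n,
          pairing (V R I) (gProd R J) * pairing (M R J.reverse) (g R n)) ∧
    (∀ I J : Composition n,
      pairing (V R I) (gProd R J) = (-1) ^ (n - I.length) * (numQuasiRibbons I J : R)) ∧
    (∀ J : Composition n, pairing (M R J.reverse) (g R n) = (numNDPF J.reverse : R)) ∧
    HopfAlgebra.antipode R (g R n) =
      ∑ I : Composition n, ((-1) ^ I.length *
        ((∑ J : Composition n, numQuasiRibbons I J * numNDPF J.reverse : ℕ) : R)) •
          gProd R I := by
  exact ⟨antipode_g n, pairing_c_antipode_g, pairing_V_gProd, fun _ => pairing_M_g _,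
    antipode_g_eq_sum n⟩
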